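/- For an oriented ribbon graph $G$ with $v(G)$ vertices, $e(G)$ edges, $f(G)$ faces and $c(G)$ components let $\gamma(G)=c(G)-\frac12\bigl(v(G)-e(G)+f(G)\bigr)$ be its orientable genus; $G$ is planar if $\gamma(G)=0$. For $A\subseteq E(G)$ let $G^A$ be the (Chmutov) partial dual of $G$ with respect to $A$. Let $\gamma_i(G)$ be the number of $A\subseteq E(G)$ with $\gamma(G^A)=i$, and let $X_G$ be the random variable with $\mathbb P(X_G=i)=\gamma_i(G)/2^{e(G)}$, $i\ge 0$ (the partial-dual genus distribution of $G$). For $n\ge 0$ the standard fan graph $F_{(2,n,2)}$ is the multigraph obtained from a path with $n+2$ vertices by adding a new vertex $v_1$, joining $v_1$ by one edge to each vertex of the path, and then adding a second edge between $v_1$ and each of the two end-vertices of the path. **Theorem.** For each $n$ let $F_n$ be a planar ribbon graph whose underlying graph is $F_{(2,n,2)}$, and write $X_n=X_{F_n}$. The partial-dual genus distribution of $F_n$ is asymptotically normal, with mean $\frac{2(n+3)}{3}$ and variance $\frac{4(n+3)}{27}$, as $n\to\infty$. That is, as $n\to\infty$, $$\mathbb E(X_n)\sim\frac{2(n+3)}{3},\qquad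 \operatorname{Var}(X_n)\sim\frac{4(n+3)}{27},$$ and for every $x\in\mathbb R$ $$\lim_{n\to\infty}\mathbb P\left(\frac{X_n-\mu_n}{\sqrt{v_n}}\le x\right)=\int_{-\infty}^x\frac{1}{\sqrt{2\pi}}e^{-u^2/2}\,du,$$ both for $\mu_n=\mathbb E(X_n)$, $v_n=\operatorname{Var}(X_n)$ and for $\mu_n=\frac{2(n+3)}{3}$, $v_n=\frac{4(n+3)}{27}$. -/

import Mathlib

open MeasureTheory ProbabilityTheory Filter Topology

/-- An oriented ribbon graph with ribbon set `E` and no isolated vertex-disks.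
Each ribbon `e` has the two ends `(e, false)` and `(e, true)`; `rot` is the rotation system: it sends
a ribbon end to the next one along the boundary of the vertex-disk to which it is attached. -/
structure RibbonGraph (E : Type) where
  rot : Equiv.Perm (E × Bool)

namespace RibbonGraph

variable {E : Type}

open Classical in
/-- Exchange the two ends of each ribbon in `A` and fix all other ribbon ends. -/
noncomputable def flip (A : Finset E) : Equiv.Perm (E × Bool) :=
  Function.Involutive.toPerm (fun d => if d.1 ∈ A then (d.1, !d.2) else d) (by
    rintro ⟨e, b⟩
    by_cases h : e ∈ A <;> simp [h])

/-- The number of cycles of a permutation, fixed points included. -/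
noncomputable def numCycles {D : Type} (p : Equiv.Perm D) : ℕ :=
  Nat.card (Quotient (Equiv.Perm.SameCycle.setoid p))

/-- The vertex-disks correspond to the cycles of the rotation system. -/
noncomputable def numVertices (G : RibbonGraph E) : ℕ := numCycles G.rot

/-- The boundary components of the spanning ribbon subgraph `(V(G), A)`. Following such a boundary
component one passes by the arcs where ribbons outside `A` are attached, and runs along the sides of
the ribbons in `A` to their other ends, so that the arcs met are those of a cycle of
`G.rot * flip A`. -/
noncomputable def numBoundary (G : RibbonGraph E) (A : Finset E) : ℕ :=
  numCycles (G.rot * flip A)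

/-- The number of faces, i.e. of boundary components of the whole ribbon graph. -/
noncomputable def numFaces [Fintype E] (G : RibbonGraph E) : ℕ := G.numBoundary Finset.univ

/-- The number of connected components: orbits of ribbon ends under moving around a vertex-disk
and along a ribbon. -/
noncomputable def numComponents [Fintype E] (G : RibbonGraph E) : ℕ :=
  Nat.card (MulAction.orbitRel.Quotient
    (Subgroup.closure {G.rot, flip (Finset.univ : Finset E)}) (E × Bool))

/-- The orientable genus `γ(G) = c(G) - (v(G) - e(G) + f(G)) / 2`. -/
noncomputable def genus [Fintype E] (G : RibbonGraph E) : ℝ :=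
  G.numComponents - ((G.numVertices : ℝ) - Fintype.card E + G.numFaces) / 2

/-- A ribbon graph is planar if its genus is `0`. -/
def IsPlanar [Fintype E] (G : RibbonGraph E) : Prop := G.genus = 0

/-- The partial dual `G^A`: the boundary components of `(V(G), A)` become the vertex-disks, and each
ribbon end becomes attached to the arc where that boundary component meets its ribbon. -/
noncomputable def partialDual (G : RibbonGraph E) (A : Finset E) : RibbonGraph E where
  rot := G.rot * flip A

/-- `G` is a ribbon graph (an embedding in oriented surfaces) of the abstract multigraph with vertex
set `V` in which the edge `e` joins the two (possibly equal) vertices of `ends e`. -/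
def IsEmbeddingOf {V : Type} (G : RibbonGraph E) (ends : E → Sym2 V) : Prop :=
  ∃ att : E × Bool → V, Function.Surjective att ∧
    (∀ d d', att d = att d' ↔ G.rot.SameCycle d d') ∧
    ∀ e, s(att (e, false), att (e, true)) = ends e

section Distribution

variable [Fintype E]

open Classical in
/-- `γ_i(G)`: the number of partial duals of `G` with genus `i`, over all `2 ^ e(G)` subsets. -/
noncomputable def pdCount (G : RibbonGraph E) (i : ℕ) : ℕ :=
  (Finset.univ.filter fun A : Finset E => (G.partialDual A).genus = i).card

/-- The law of the random variable `X_G`, the genus of the partial dual `G^A` of `G`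
for a uniformly random set of ribbons `A`. -/
noncomputable def pdLaw (G : RibbonGraph E) : Measure ℝ :=
  ((2 : ENNReal) ^ Fintype.card E)⁻¹ • ∑ A : Finset E, Measure.dirac (G.partialDual A).genus

instance (G : RibbonGraph E) : IsProbabilityMeasure G.pdLaw where
  measure_univ := by
    simp only [pdLaw, Measure.smul_apply, Measure.finsetSum_apply, measure_univ, smul_eq_mul,
      Finset.sum_const, Finset.card_univ, Fintype.card_finset, nsmul_eq_mul, mul_one]
    push_cast
    exact ENNReal.inv_mul_cancel (by simp) (by simp)

/-- `P(X_G = i) = γ_i(G) / 2 ^ e(G)`. -/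
theorem pdLaw_singleton (G : RibbonGraph E) (i : ℕ) :
    G.pdLaw.real {(i : ℝ)} = G.pdCount i / 2 ^ Fintype.card E := by
  classical
  have h : ∀ A : Finset E, Measure.dirac (G.partialDual A).genus {(i : ℝ)}
      = if (G.partialDual A).genus = i then (1 : ENNReal) else 0 := by
    intro A
    rw [Measure.dirac_apply' _ (measurableSet_singleton _)]
    simp [Set.indicator_apply]
  simp only [Measure.real, pdLaw, Measure.smul_apply, Measure.finsetSum_apply, h, smul_eq_mul,
    Finset.sum_boole, pdCount, ENNReal.toReal_mul, ENNReal.toReal_inv, ENNReal.toReal_pow,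
    ENNReal.toReal_ofNat, ENNReal.toReal_natCast]
  rw [div_eq_inv_mul]

/-- The mean of the partial-dual genus distribution. -/
noncomputable def pdMean (G : RibbonGraph E) : ℝ := ∫ y, y ∂G.pdLaw

/-- The variance of the partial-dual genus distribution. -/
noncomputable def pdVariance (G : RibbonGraph E) : ℝ := Var[id; G.pdLaw]

end Distribution

end RibbonGraph

/-- `(X_n - m_n) / √(v_n)` converges in distribution to the standard normal law,
where `X_n` has law `μ n`. -/
def IsAsymptoticallyNormalWith (μ : ℕ → Measure ℝ) (m v : ℕ → ℝ) : Prop :=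
  ∀ x : ℝ, Tendsto (fun n => (μ n).real {y | (y - m n) / √(v n) ≤ x}) atTop
    (𝓝 (∫ u in Set.Iic x, 1 / √(2 * Real.pi) * Real.exp (-(1 / 2) * u ^ 2)))

/-- The vertices of `F_{(2,n,2)}`: the vertex `hub` and the vertices
`path 0, …, path (n + 1)` of a path on `n + 2` vertices. -/
inductive FanVertex (n : ℕ) : Type
  | hub : FanVertex n
  | path (i : Fin (n + 2)) : FanVertex n

/-- The edges of `F_{(2,n,2)}`: those of the path, one spoke from the hub to each vertex of the
path, and one further spoke to each of the two end-vertices of the path. -/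
inductive FanEdge (n : ℕ) : Type
  | rim (i : Fin (n + 1)) : FanEdge n
  | spoke (i : Fin (n + 2)) : FanEdge n
  | extraFirst : FanEdge n
  | extraLast : FanEdge n
  deriving Fintype

/-- The abstract multigraph `F_{(2,n,2)}`, given by the ends of its edges. -/
def fanEnds (n : ℕ) : FanEdge n → Sym2 (FanVertex n)
  | .rim i => s(.path i.castSucc, .path i.succ)
  | .spoke i => s(.hub, .path i)
  | .extraFirst => s(.hub, .path 0)
  | .extraLast => s(.hub, .path (Fin.last (n + 1)))

/-! A planar ribbon graph with underlying graph `F_{(2,n,2)}` exists for every `n`. -/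

namespace FanWitness

variable {n : ℕ}

def rotFun : FanEdge n × Bool → FanEdge n × Bool
  | (.extraFirst, false) => (.extraLast, false)
  | (.extraLast, false) => (.spoke (Fin.last _), false)
  | (.spoke i, false) => Fin.cases (.extraFirst, false) (fun j => (.spoke j.castSucc, false)) i
  | (.rim i, false) => Fin.cases (.extraFirst, true) (fun j => (.rim j.castSucc, true)) i
  | (.extraFirst, true) => (.spoke 0, true)
  | (.rim i, true) => (.spoke i.succ, true)
  | (.spoke i, true) => Fin.lastCases (.extraLast, true) (fun j => (.rim j, false)) i
  | (.extraLast, true) => (.rim (Fin.last _), true)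

def invFun : FanEdge n × Bool → FanEdge n × Bool
  | (.extraFirst, false) => (.spoke 0, false)
  | (.extraLast, false) => (.extraFirst, false)
  | (.spoke i, false) => Fin.lastCases (.extraLast, false) (fun j => (.spoke j.succ, false)) i
  | (.rim i, false) => (.spoke i.castSucc, true)
  | (.extraFirst, true) => (.rim 0, false)
  | (.rim i, true) => Fin.lastCases (.extraLast, true) (fun j => (.rim j.succ, false)) i
  | (.spoke i, true) => Fin.cases (.extraFirst, true) (fun j => (.rim j, true)) i
  | (.extraLast, true) => (.spoke (Fin.last _), true)

def rot (n : ℕ) : Equiv.Perm (FanEdge n × Bool) where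
  toFun := rotFun
  invFun := invFun
  left_inv := by
    rintro ⟨i | i | _ | _, _ | _⟩ <;> try simp [rotFun, invFun]
    · refine Fin.cases ?_ (fun j => ?_) i <;> simp
    · refine Fin.cases ?_ (fun j => ?_) i <;> simp
    · refine Fin.lastCases ?_ (fun j => ?_) i <;> simp
  right_inv := by
    rintro ⟨i | i | _ | _, _ | _⟩ <;> try simp [rotFun, invFun]
    · refine Fin.lastCases ?_ (fun j => ?_) i <;> simp
    · refine Fin.lastCases ?_ (fun j => ?_) i <;> simp
    · refine Fin.cases ?_ (fun j => ?_) i <;> simp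

def att : FanEdge n × Bool → FanVertex n
  | (.extraFirst, false) => .hub
  | (.extraLast, false) => .hub
  | (.spoke _, false) => .hub
  | (.rim i, false) => .path i.castSucc
  | (.extraFirst, true) => .path 0
  | (.rim i, true) => .path i.succ
  | (.spoke i, true) => .path i
  | (.extraLast, true) => .path (Fin.last _)

def rep : FanVertex n → FanEdge n × Bool
  | .hub => (.extraLast, false)
  | .path i => (.spoke i, true)

/-- The outer face, the two digons and the triangles. -/
def face : FanEdge n × Bool → Option (Option (Option (Fin (n + 1))))
  | (.extraFirst, false) => some none
  | (.extraLast, false) => none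
  | (.spoke i, false) => Fin.lastCases (some (some none)) (fun j => some (some (some j))) i
  | (.rim i, false) => some (some (some i))
  | (.extraFirst, true) => none
  | (.rim _, true) => none
  | (.spoke i, true) => Fin.cases (some none) (fun j => some (some (some j))) i
  | (.extraLast, true) => some (some none)

def faceRep : Option (Option (Option (Fin (n + 1)))) → FanEdge n × Bool
  | none => (.extraLast, false)
  | some none => (.extraFirst, false)
  | some (some none) => (.extraLast, true)
  | some (some (some i)) => (.rim i, false)

section Cycles

variable {D L : Type} {p : Equiv.Perm D} {label : D → L} {r : L → D}

theorem eq_of_sameCycle (h1 : ∀ d, label (p d) = label d) {d d' : D} (h : p.SameCycle d d') :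
    label d = label d' := by
  obtain ⟨k, rfl⟩ := h
  have hinv : ∀ d, label (p⁻¹ d) = label d := fun d => by
    have := h1 (p⁻¹ d); simpa using this.symm
  induction k with
  | zero => simp
  | succ k ih => rw [add_comm, zpow_add, Equiv.Perm.mul_apply, zpow_one, h1]; exact ih
  | pred k ih =>
    rw [sub_eq_add_neg, add_comm, zpow_add, Equiv.Perm.mul_apply, zpow_neg_one, hinv]; exact ih

theorem label_eq_iff (h1 : ∀ d, label (p d) = label d)
    (h3 : ∀ d, p.SameCycle (r (label d)) d) (d d' : D) : label d = label d' ↔ p.SameCycle d d' :=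
  ⟨fun h => (h3 d).symm.trans (h ▸ h3 d'), eq_of_sameCycle h1⟩

theorem numCycles_eq (h1 : ∀ d, label (p d) = label d) (h2 : ∀ l, label (r l) = l)
    (h3 : ∀ d, p.SameCycle (r (label d)) d) : RibbonGraph.numCycles p = Nat.card L := by
  refine Nat.card_eq_of_bijective
    (Quotient.lift label fun _ _ h => eq_of_sameCycle h1 h) ⟨?_, fun l => ⟨⟦r l⟧, h2 l⟩⟩
  rintro ⟨d⟩ ⟨d'⟩ h
  exact Quotient.sound ((label_eq_iff h1 h3 d d').1 h)

end Cycles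

theorem att_rot (d : FanEdge n × Bool) : att (rot n d) = att d := by
  obtain ⟨i | i | _ | _, _ | _⟩ := d <;> try simp [rot, rotFun, att]
  · refine Fin.cases ?_ (fun j => ?_) i <;> simp
  · refine Fin.cases ?_ (fun j => ?_) i <;> simp
  · refine Fin.lastCases ?_ (fun j => ?_) i <;> simp

theorem att_rep (v : FanVertex n) : att (rep v) = v := by cases v <;> rfl

theorem step {D : Type} {p : Equiv.Perm D} {d d' : D} (h : p d = d') : p.SameCycle d d' :=
  ⟨1, by simpa using h⟩

theorem sameCycle_att (d : FanEdge n × Bool) : (rot n).SameCycle (rep (att d)) d := by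
  have hs : ∀ i : Fin (n + 2), (rot n).SameCycle (.extraLast, false) (.spoke i, false) := by
    intro i
    induction i using Fin.reverseInduction with
    | last => exact step rfl
    | cast i ih => exact ih.trans (step (by simp [rot, rotFun]))
  obtain ⟨i | i | _ | _, _ | _⟩ := d
  · exact step (by simp [rot, rotFun, rep, att])
  · exact (step (by simp [rot, rotFun, rep, att])).symm
  · exact hs i
  · exact .refl _ _
  · exact (hs 0).trans (step rfl)
  · exact (step (by simp [rot, rotFun, rep, att])).symm
  · exact .refl _ _
  · exact step (by simp [rot, rotFun, rep, att])

noncomputable def facePerm (n : ℕ) : Equiv.Perm (FanEdge n × Bool) :=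
  rot n * RibbonGraph.flip Finset.univ

theorem facePerm_apply (e : FanEdge n) (b : Bool) : facePerm n (e, b) = rotFun (e, !b) := by
  simp [facePerm, RibbonGraph.flip, rot]

theorem face_facePerm (d : FanEdge n × Bool) : face (facePerm n d) = face d := by
  obtain ⟨i | i | _ | _, _ | _⟩ := d <;> rw [facePerm_apply] <;> try simp [rotFun, face]
  · refine Fin.cases ?_ (fun j => ?_) i <;> simp
  · refine Fin.lastCases ?_ (fun j => ?_) i <;> simp
  · refine Fin.cases ?_ (fun j => ?_) i <;> simp

theorem face_faceRep (l : Option (Option (Option (Fin (n + 1))))) : face (faceRep l) = l := by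
  obtain _ | _ | _ | i := l <;> rfl

theorem sameCycle_face (d : FanEdge n × Bool) :
    (facePerm n).SameCycle (faceRep (face d)) d := by
  have hr : ∀ i : Fin (n + 1), (facePerm n).SameCycle (.extraLast, false) (.rim i, true) := by
    intro i
    induction i using Fin.reverseInduction with
    | last => exact step (by simp [facePerm_apply, rotFun])
    | cast i ih => exact ih.trans (step (by simp [facePerm_apply, rotFun]))
  obtain ⟨i | i | _ | _, _ | _⟩ := d
  · exact .refl _ _
  · exact hr i
  · refine Fin.lastCases ?_ (fun j => ?_) i
    · exact step (by simp [facePerm_apply, rotFun, face, faceRep])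
    · exact (step (by simp [facePerm_apply, rotFun, face, faceRep])).symm
  · refine Fin.cases ?_ (fun j => ?_) i <;>
      exact step (by simp [facePerm_apply, rotFun, face, faceRep])
  · exact .refl _ _
  · exact (hr 0).trans (step (by simp [facePerm_apply, rotFun]))
  · exact .refl _ _
  · exact .refl _ _

end FanWitness

/-- The hypotheses put on the ribbon graphs `F_{(2,n,2)}` can be satisfied for every `n`. -/
theorem exists_planar_fan (n : ℕ) :
    ∃ G : RibbonGraph (FanEdge n), G.IsEmbeddingOf (fanEnds n) ∧ G.IsPlanar := by
  open FanWitness in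
  have hV : RibbonGraph.numVertices ⟨rot n⟩ = n + 3 := by
    rw [RibbonGraph.numVertices, numCycles_eq att_rot att_rep sameCycle_att,
      Nat.card_congr (β := Option (Fin (n + 2))) ⟨fun | .hub => none | .path i => some i,
        fun | none => .hub | some i => .path i, by rintro (_ | _) <;> rfl,
        by rintro (_ | _) <;> rfl⟩]
    simp
  have hFc : RibbonGraph.numFaces ⟨rot n⟩ = n + 4 := by
    have := numCycles_eq (p := facePerm n) face_facePerm face_faceRep sameCycle_face
    simpa [RibbonGraph.numFaces, RibbonGraph.numBoundary, facePerm] using this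
  have hE : Fintype.card (FanEdge n) = 2 * n + 5 := by
    rw [Fintype.card_congr (β := Fin (n + 1) ⊕ Fin (n + 2) ⊕ Bool)
      ⟨fun | .rim i => .inl i | .spoke i => .inr (.inl i) | .extraFirst => .inr (.inr false)
           | .extraLast => .inr (.inr true),
       fun | .inl i => .rim i | .inr (.inl i) => .spoke i | .inr (.inr false) => .extraFirst
           | .inr (.inr true) => .extraLast, by rintro (_ | _ | _ | _) <;> rfl,
       by rintro (_ | _ | _ | _) <;> rfl⟩]
    simp; ring
  have hC : RibbonGraph.numComponents (⟨rot n⟩ : RibbonGraph (FanEdge n)) = 1 := by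
    set H := Subgroup.closure {rot n, RibbonGraph.flip (Finset.univ : Finset (FanEdge n))}
    have hflip : ∀ e b, (e, !b) ∈ MulAction.orbit H ((e, b) : FanEdge n × Bool) := fun e b =>
      ⟨⟨RibbonGraph.flip Finset.univ, Subgroup.subset_closure (by simp)⟩, by
        simp [Subgroup.smul_def, RibbonGraph.flip]⟩
    have hcyc : ∀ d d', (rot n).SameCycle d d' → d' ∈ MulAction.orbit H d := by
      rintro d _ ⟨k, rfl⟩
      exact ⟨⟨rot n ^ k, Subgroup.zpow_mem _ (Subgroup.subset_closure (by simp)) k⟩, rfl⟩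
    have hhub : ∀ d, MulAction.orbit H d = MulAction.orbit H ((.extraLast, false) :
        FanEdge n × Bool) := by
      intro d
      rw [← MulAction.orbit_eq_iff.2 (hcyc _ _ (sameCycle_att d).symm)]
      cases att d with
      | hub => rfl
      | path i =>
        rw [rep, ← MulAction.orbit_eq_iff.2 (hflip (.spoke i) true)]
        exact MulAction.orbit_eq_iff.2 (hcyc _ _ (sameCycle_att (.spoke i, false)))
    rw [RibbonGraph.numComponents, Nat.card_eq_one_iff_unique]
    refine ⟨⟨?_⟩, ⟨Quotient.mk'' (.extraLast, false)⟩⟩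
    rintro ⟨d⟩ ⟨d'⟩
    exact Quotient.sound' (MulAction.orbit_eq_iff.1 ((hhub d).trans (hhub d').symm))
  refine ⟨⟨rot n⟩, ⟨att, fun v => ⟨rep v, att_rep v⟩, label_eq_iff att_rot sameCycle_att, ?_⟩, ?_⟩
  · rintro (i | i | _ | _) <;> rfl
  · rw [RibbonGraph.IsPlanar, RibbonGraph.genus, hV, hFc, hE, hC]
    push_cast
    ring

/-! Write r(A) = |V| - c(A) for the rank of an edge set. For a plane graph, Euler's formula holds
for every spanning subgraph (`numBoundary_of_isPlanar`), and the vertices and faces of the partial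
dual are the boundary components of A and of its complement. Hence γ(G^A) = r(A) + r(Aᶜ) - r(E)
(`genus_partialDual`), which no longer depends on the embedding.

For the fan, r(A) is computed by sweeping along the path, remembering only whether the current
vertex is linked to the hub and the rank so far. Regard A and Aᶜ as two colours. Each vertex of the
path has a spoke, so at least one colour always links it to the hub, and the joint state reduces to
one Boolean (do both colours link it?) and the sum of the two ranks. For a uniformly random A this
is a two-state Markov chain with an additive counter, so every expectation of the genus is obtained
by iterating the averaging operator `walkOp` (`integral_pdLaw`).

The polynomials of degree at most two in the counter that are needed for the moments span a
finite-dimensional invariant space, which gives exact formulas for mean and variance. On functions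
τ^c times a function of the state, with τ = exp(is), the operator is a 2×2 matrix. Its dominant
eigenvalue divided by τ agrees with exp(2is/3 - 2s²/27) up to O(s³). With s of order n^(-1/2), n
steps accumulate an error O(n^(-1/2)), so the normalised characteristic functions converge to the
Gaussian one, and Lévy's theorem applies. -/

section Glue

/-! ### Identifying two classes of an equivalence relation -/

variable {V : Type}

/-- The finest equivalence relation that is coarser than `s` and relates `x` and `y`. -/
def Setoid.glue (s : Setoid V) (x y : V) : Setoid V where
  r a b := s a b ∨ (s a x ∧ s y b) ∨ (s a y ∧ s x b)
  iseqv :=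
    { refl := fun a => Or.inl (s.refl a)
      symm := by
        rintro a b (h | ⟨h, h'⟩ | ⟨h, h'⟩)
        · exact Or.inl (s.symm h)
        · exact Or.inr (Or.inr ⟨s.symm h', s.symm h⟩)
        · exact Or.inr (Or.inl ⟨s.symm h', s.symm h⟩)
      trans := by
        rintro a b c (h | ⟨h, h'⟩ | ⟨h, h'⟩) (k | ⟨k, k'⟩ | ⟨k, k'⟩)
        · exact Or.inl (s.trans h k)
        · exact Or.inr (Or.inl ⟨s.trans h k, k'⟩)
        · exact Or.inr (Or.inr ⟨s.trans h k, k'⟩)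
        · exact Or.inr (Or.inl ⟨h, s.trans h' k⟩)
        · exact Or.inr (Or.inl ⟨h, k'⟩)
        · exact Or.inl (s.trans h k')
        · exact Or.inr (Or.inr ⟨h, s.trans h' k⟩)
        · exact Or.inl (s.trans h k')
        · exact Or.inr (Or.inr ⟨h, k'⟩) }

namespace Setoid

variable (s : Setoid V) (x y : V)

theorem le_glue : s ≤ s.glue x y := fun _ _ h => Or.inl h

theorem glue_self : s.glue x y x y := Or.inr (Or.inl ⟨s.refl x, s.refl y⟩)

variable {s x y}

theorem glue_le {t : Setoid V} (h : s ≤ t) (hxy : t x y) : s.glue x y ≤ t := by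
  rintro a b (k | ⟨k, k'⟩ | ⟨k, k'⟩)
  · exact h k
  · exact t.trans (h k) (t.trans hxy (h k'))
  · exact t.trans (h k) (t.trans (t.symm hxy) (h k'))

theorem glue_eq_self (h : s x y) : s.glue x y = s :=
  le_antisymm (glue_le le_rfl h) (le_glue s x y)

/-- The classes other than that of `y` are in bijection with the glued classes, since the class of
`y` is absorbed by that of `x`. -/
theorem card_quotient_glue_add_one [Finite V] (h : ¬ s x y) :
    Nat.card (Quotient (s.glue x y)) + 1 = Nat.card (Quotient s) := by
  classical
  have hb : Nat.card {q : Quotient s // q ≠ ⟦y⟧} = Nat.card (Quotient (s.glue x y)) := by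
    refine Nat.card_eq_of_bijective
      (fun q => Quotient.map' (s₂ := s.glue x y) id (fun _ _ hab => le_glue s x y hab) q.1) ⟨?_, ?_⟩
    · rintro ⟨⟨a⟩, ha⟩ ⟨⟨b⟩, hb⟩ hab
      have ha' : ¬ s a y := fun k => ha (Quotient.sound k)
      have hb' : ¬ s b y := fun k => hb (Quotient.sound k)
      apply Subtype.ext
      rcases Quotient.exact hab with k | ⟨_, k⟩ | ⟨k, _⟩
      · exact Quotient.sound k
      · exact absurd (s.symm k) hb'
      · exact absurd k ha'
    · rintro ⟨a⟩
      by_cases ha : s a y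
      · exact ⟨⟨⟦x⟧, fun k => h (Quotient.exact k)⟩,
          Quotient.sound (Or.inr (Or.inl ⟨s.refl x, s.symm ha⟩))⟩
      · exact ⟨⟨⟦a⟧, fun k => ha (Quotient.exact k)⟩, rfl⟩
  rw [← hb]
  have := Fintype.ofFinite (Quotient s)
  have hpos : 0 < Fintype.card (Quotient s) := Fintype.card_pos_iff.2 ⟨⟦y⟧⟩
  rw [Nat.card_eq_fintype_card, Nat.card_eq_fintype_card, Fintype.card_subtype_compl,
    Fintype.card_subtype_eq]
  omega

theorem card_quotient_le_glue_add_one [Finite V] :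
    Nat.card (Quotient s) ≤ Nat.card (Quotient (s.glue x y)) + 1 := by
  by_cases h : s x y
  · rw [glue_eq_self h]; omega
  · exact (card_quotient_glue_add_one h).ge

theorem card_quotient_glue_le [Finite V] :
    Nat.card (Quotient (s.glue x y)) ≤ Nat.card (Quotient s) := by
  by_cases h : s x y
  · rw [glue_eq_self h]
  · rw [← card_quotient_glue_add_one h]; omega

end Setoid

end Glue

/-! ### Cycle counts under multiplication by a transposition -/

section Cycles

variable {D : Type} {p : Equiv.Perm D} {a b : D}

theorem sameCycle_setoid_le {t : Setoid D} (h : ∀ d, t (p d) d) :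
    Equiv.Perm.SameCycle.setoid p ≤ t := fun _ _ hd =>
  Quotient.exact (FanWitness.eq_of_sameCycle (label := Quotient.mk t)
    (fun d => Quotient.sound (h d)) hd)

theorem sameCycle_setoid_mul_swap_le [DecidableEq D] {t : Setoid D}
    (h : Equiv.Perm.SameCycle.setoid p ≤ t) (hab : t a b) :
    Equiv.Perm.SameCycle.setoid (p * Equiv.swap a b) ≤ t := by
  apply sameCycle_setoid_le
  intro d
  refine t.trans (h (FanWitness.step rfl).symm) ?_
  by_cases ha : d = a
  · subst ha; rw [Equiv.swap_apply_left]; exact t.symm hab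
  by_cases hb : d = b
  · subst hb; rw [Equiv.swap_apply_right]; exact hab
  rw [Equiv.swap_apply_of_ne_of_ne ha hb]

/-- Once `a` and `b` are identified, the transposition is invisible. Both cycle counts are thus
within one of a common number, so one inclusion, applied to `p` and to `p * swap a b`, suffices. -/
theorem glue_sameCycle_mul_swap [DecidableEq D] :
    (Equiv.Perm.SameCycle.setoid (p * Equiv.swap a b)).glue a b =
      (Equiv.Perm.SameCycle.setoid p).glue a b := by
  have key : ∀ q : Equiv.Perm D, (Equiv.Perm.SameCycle.setoid (q * Equiv.swap a b)).glue a b ≤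
      (Equiv.Perm.SameCycle.setoid q).glue a b := fun q =>
    Setoid.glue_le (sameCycle_setoid_mul_swap_le (Setoid.le_glue _ _ _) (Setoid.glue_self _ _ _))
      (Setoid.glue_self _ _ _)
  refine le_antisymm (key p) ?_
  simpa [mul_assoc] using key (p * Equiv.swap a b)

/-- The transposition merges two distinct cycles: from `a` the new permutation jumps to `p b` and
then follows the old cycle of `b`, which avoids `a`, until it reaches `b`. -/
theorem sameCycle_mul_swap [Finite D] [DecidableEq D] (h : ¬ p.SameCycle a b) :
    (p * Equiv.swap a b).SameCycle a b := by
  have key : ∀ j : ℕ, (p * Equiv.swap a b).SameCycle a ((p ^ (j + 1)) b) := by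
    intro j
    have h0 : (p * Equiv.swap a b).SameCycle a (p b) := FanWitness.step (by simp)
    induction j with
    | zero => simpa using h0
    | succ j ih =>
      rw [pow_succ', Equiv.Perm.mul_apply]
      set z := (p ^ (j + 1)) b with hz
      have hza : z ≠ a := fun hza => h (Equiv.Perm.SameCycle.symm ⟨(j + 1 : ℕ), by
        rw [zpow_natCast, ← hz, hza]⟩)
      by_cases hzb : z = b
      · rw [hzb]; exact h0
      · exact ih.trans (FanWitness.step (by
          rw [Equiv.Perm.mul_apply, Equiv.swap_apply_of_ne_of_ne hza hzb]))
  -- With this exponent the power of `p` is the identity, so the walk has arrived at `b`.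
  have := key (orderOf p - 1)
  rwa [Nat.sub_add_cancel (orderOf_pos p), pow_orderOf_eq_one] at this

namespace RibbonGraph

theorem numCycles_mul_swap_le [Finite D] [DecidableEq D] :
    numCycles (p * Equiv.swap a b) ≤ numCycles p + 1 := by
  refine (Setoid.card_quotient_le_glue_add_one (x := a) (y := b)).trans ?_
  rw [glue_sameCycle_mul_swap]
  exact Nat.add_le_add_right Setoid.card_quotient_glue_le 1

theorem numCycles_mul_swap_of_not_sameCycle [Finite D] [DecidableEq D] (h : ¬ p.SameCycle a b) :
    numCycles (p * Equiv.swap a b) + 1 = numCycles p := by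
  have h1 := Setoid.card_quotient_glue_add_one (s := Equiv.Perm.SameCycle.setoid p) h
  rwa [← glue_sameCycle_mul_swap,
    Setoid.glue_eq_self (s := Equiv.Perm.SameCycle.setoid (p * Equiv.swap a b))
      (sameCycle_mul_swap h)] at h1

end RibbonGraph

end Cycles

/-! ### Components of spanning subgraphs -/

section Components

variable {V E : Type}

/-- The vertices `x` and `y` are joined by a path of edges in `B`. -/
def linkSetoid (ends : E → Sym2 V) (B : Finset E) : Setoid V :=
  Relation.EqvGen.setoid fun x y => ∃ e ∈ B, ends e = s(x, y)

/-- The number of connected components of the spanning subgraph with edge set `B`. -/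
noncomputable def numComp (ends : E → Sym2 V) (B : Finset E) : ℕ :=
  Nat.card (Quotient (linkSetoid ends B))

variable {ends : E → Sym2 V}

theorem linkSetoid_le {B : Finset E} {t : Setoid V}
    (h : ∀ x y, ∀ e ∈ B, ends e = s(x, y) → t x y) : linkSetoid ends B ≤ t := by
  rintro x y hxy
  induction hxy with
  | rel x y hxy => obtain ⟨e, he, hee⟩ := hxy; exact h x y e he hee
  | refl x => exact t.refl x
  | symm x y _ ih => exact t.symm ih
  | trans x y z _ _ ih ih' => exact t.trans ih ih'

theorem linkSetoid_of_mem {B : Finset E} {e : E} (he : e ∈ B) {x y : V} (h : ends e = s(x, y)) :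
    linkSetoid ends B x y := .rel _ _ ⟨e, he, h⟩

theorem linkSetoid_empty : linkSetoid ends ∅ = ⊥ :=
  le_bot_iff.1 (linkSetoid_le (by simp))

theorem linkSetoid_mono {A B : Finset E} (h : A ⊆ B) : linkSetoid ends A ≤ linkSetoid ends B :=
  linkSetoid_le fun _ _ _ he hxy => linkSetoid_of_mem (h he) hxy

theorem linkSetoid_insert [DecidableEq E] {B : Finset E} {e : E} {x y : V} (h : ends e = s(x, y)) :
    linkSetoid ends (insert e B) = (linkSetoid ends B).glue x y := by
  apply le_antisymm
  · apply linkSetoid_le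
    intro a b f hf hab
    rcases Finset.mem_insert.1 hf with rfl | hf
    · rw [h, Sym2.eq_iff] at hab
      rcases hab with ⟨rfl, rfl⟩ | ⟨rfl, rfl⟩
      · exact Setoid.glue_self _ _ _
      · exact Setoid.symm' _ (Setoid.glue_self _ _ _)
    · exact Setoid.le_glue _ _ _ (linkSetoid_of_mem hf hab)
  · exact Setoid.glue_le (linkSetoid_mono (Finset.subset_insert _ _))
      (linkSetoid_of_mem (Finset.mem_insert_self _ _) h)

theorem numComp_empty : numComp ends ∅ = Nat.card V := by
  rw [numComp, linkSetoid_empty]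
  exact Nat.card_congr ⟨Quotient.lift id (fun _ _ h => h), Quotient.mk _, by rintro ⟨x⟩; rfl,
    fun _ => rfl⟩

theorem numComp_insert_of_linked [DecidableEq E] {B : Finset E} {e : E} {x y : V}
    (h : ends e = s(x, y)) (hxy : linkSetoid ends B x y) :
    numComp ends (insert e B) = numComp ends B := by
  rw [numComp, linkSetoid_insert h, Setoid.glue_eq_self hxy, numComp]

theorem numComp_insert_of_not_linked [Finite V] [DecidableEq E] {B : Finset E} {e : E} {x y : V}
    (h : ends e = s(x, y)) (hxy : ¬ linkSetoid ends B x y) :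
    numComp ends (insert e B) + 1 = numComp ends B := by
  rw [numComp, linkSetoid_insert h, Setoid.card_quotient_glue_add_one hxy, numComp]

end Components

/-! ### Euler's formula for spanning subgraphs and the genus of a partial dual -/

namespace RibbonGraph

variable {V E : Type} {G : RibbonGraph E} {ends : E → Sym2 V}

theorem flip_apply [DecidableEq E] (A : Finset E) (e : E) (b : Bool) :
    flip A (e, b) = if e ∈ A then (e, !b) else (e, b) := by
  by_cases h : e ∈ A
  · rw [if_pos h]; exact if_pos h
  · rw [if_neg h]; exact if_neg h

theorem flip_empty : flip (∅ : Finset E) = 1 := by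
  ext ⟨e, b⟩ <;> simp [flip]

theorem flip_insert [DecidableEq E] {B : Finset E} {e : E} (he : e ∉ B) :
    flip (insert e B) = flip B * Equiv.swap (e, false) (e, true) := by
  apply Equiv.ext
  rintro ⟨f, b⟩
  rw [Equiv.Perm.mul_apply, flip_apply]
  by_cases hf : f = e
  · subst hf
    cases b <;> simp [flip_apply, he]
  · rw [Equiv.swap_apply_of_ne_of_ne (by simp [hf]) (by simp [hf]), flip_apply]
    simp [hf]

theorem flip_mul_flip_univ [Fintype E] [DecidableEq E] (A : Finset E) :
    flip A * flip Finset.univ = flip Aᶜ := by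
  apply Equiv.ext
  rintro ⟨f, b⟩
  rw [Equiv.Perm.mul_apply, flip_apply, flip_apply]
  by_cases hf : f ∈ A <;> simp [flip_apply, hf]

section Embedding

variable {att : E × Bool → V}

/-- A boundary component of (V, B) never leaves a component of (V, B); so the ends of a ribbon
joining two components lie on different boundary components. -/
theorem att_boundary (hc : ∀ d d', att d = att d' ↔ G.rot.SameCycle d d')
    (he : ∀ e, s(att (e, false), att (e, true)) = ends e) (B : Finset E) (d : E × Bool) :
    linkSetoid ends B (att ((G.rot * flip B) d)) (att d) := by
  classical
  obtain ⟨e, b⟩ := d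
  rw [Equiv.Perm.mul_apply, ← (hc _ _).2 (FanWitness.step (p := G.rot) rfl), flip_apply]
  split_ifs with h
  · cases b
    · exact Setoid.symm' _ (linkSetoid_of_mem h (he e).symm)
    · exact linkSetoid_of_mem h (he e).symm
  · exact Setoid.refl' _ _

theorem numVertices_eq_card (hs : Function.Surjective att)
    (hc : ∀ d d', att d = att d' ↔ G.rot.SameCycle d d') : G.numVertices = Nat.card V := by
  refine Nat.card_eq_of_bijective (Quotient.lift att fun d d' h => (hc d d').2 h) ⟨?_, ?_⟩
  · rintro ⟨d⟩ ⟨d'⟩ h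
    exact Quotient.sound ((hc d d').1 h)
  · intro v
    obtain ⟨d, rfl⟩ := hs v
    exact ⟨⟦d⟧, rfl⟩

/-- A ribbon joining two components merges two boundary components, and equality holds; any other
ribbon creates at most one new boundary component. -/
theorem numBoundary_insert_le [Finite E] [DecidableEq E] [Finite V]
    (hc : ∀ d d', att d = att d' ↔ G.rot.SameCycle d d')
    (he : ∀ e, s(att (e, false), att (e, true)) = ends e) {B : Finset E} {e : E} (heB : e ∉ B) :
    G.numBoundary (insert e B) + 2 * numComp ends B
      ≤ G.numBoundary B + 2 * numComp ends (insert e B) + 1 := by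
  rw [numBoundary, flip_insert heB, ← mul_assoc, numBoundary]
  by_cases h : linkSetoid ends B (att (e, false)) (att (e, true))
  · rw [numComp_insert_of_linked (he e).symm h]
    have := numCycles_mul_swap_le (p := G.rot * flip B) (a := (e, false)) (b := (e, true))
    omega
  · have h1 := numComp_insert_of_not_linked (he e).symm h
    have h2 := numCycles_mul_swap_of_not_sameCycle (p := G.rot * flip B) (a := (e, false))
      (b := (e, true)) fun h' => h (sameCycle_setoid_le
        (t := (linkSetoid ends B).comap att) (fun d => att_boundary hc he B d) h')
    omega

/-- Since `flip A` moves a ribbon end at most to the other end of its ribbon, the group generated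
has the same orbits as for `G`, and these lie over the components of the abstract graph. -/
theorem numComponents_partialDual [Fintype E] (hs : Function.Surjective att)
    (hc : ∀ d d', att d = att d' ↔ G.rot.SameCycle d d')
    (he : ∀ e, s(att (e, false), att (e, true)) = ends e) (A : Finset E) :
    (G.partialDual A).numComponents = numComp ends Finset.univ := by
  classical
  rw [numComponents, partialDual]
  set H := Subgroup.closure {G.rot * flip A, flip (Finset.univ : Finset E)} with hH
  set t : Setoid (E × Bool) := MulAction.orbitRel H (E × Bool) with ht
  have hmem : ∀ g ∈ H, ∀ d, t (g d) d := fun g hg d => ⟨⟨g, hg⟩, rfl⟩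
  have hflip : ∀ d, t (flip Finset.univ d) d := hmem _ (Subgroup.subset_closure (by simp))
  have hflipA : ∀ d, t (flip A d) d := by
    rintro ⟨e, b⟩
    have := hflip (e, b)
    rw [flip_apply] at this ⊢
    split_ifs with h
    · simpa using this
    · exact t.refl _
  have hrot : ∀ d, t (G.rot d) d := fun d => by
    have h1 := hmem _ (Subgroup.subset_closure (by simp : G.rot * flip A ∈ _)) ((flip A).symm d)
    rw [Equiv.Perm.mul_apply, Equiv.apply_symm_apply] at h1
    have h2 := hflipA ((flip A).symm d)
    rw [Equiv.apply_symm_apply] at h2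
    exact t.trans h1 (t.symm h2)
  have hatt : ∀ d d', att d = att d' → t d d' := fun d d' h =>
    sameCycle_setoid_le hrot ((hc d d').1 h)
  have hlift : ∀ d d', t d d' → linkSetoid ends Finset.univ (att d) (att d') := by
    rintro _ d ⟨⟨g, hg⟩, rfl⟩
    change linkSetoid ends Finset.univ (att (g d)) (att d)
    induction hg using Subgroup.closure_induction generalizing d with
    | mem g hg =>
      rcases hg with rfl | rfl
      · exact linkSetoid_mono (Finset.subset_univ _) (att_boundary hc he A d)
      · have := att_boundary hc he Finset.univ d
        rwa [Equiv.Perm.mul_apply, ← (hc _ _).2 (FanWitness.step (p := G.rot) rfl)] at this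
    | one => exact Setoid.refl' _ _
    | mul g g' _ _ ih ih' => exact Setoid.trans' _ (ih (g' d)) (ih' d)
    | inv g _ ih => simpa using Setoid.symm' _ (ih (g⁻¹ d))
  have hinj : ∀ x y, linkSetoid ends Finset.univ x y → ∀ d d', att d = x → att d' = y →
      t d d' := by
    intro x y hxy
    induction hxy with
    | rel x y hxy =>
      obtain ⟨e, -, hee⟩ := hxy
      have h1 : t (e, false) (e, true) := by simpa [flip_apply] using hflip (e, true)
      rintro d d' rfl rfl
      rw [← he, Sym2.eq_iff] at hee
      rcases hee with ⟨h, h'⟩ | ⟨h, h'⟩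
      · exact t.trans (hatt _ _ h.symm) (t.trans h1 (hatt _ _ h'))
      · exact t.trans (hatt _ _ h'.symm) (t.trans (t.symm h1) (hatt _ _ h))
    | refl x => rintro d d' h rfl; exact hatt _ _ h
    | symm x y _ ih => intro d d' h h'; exact t.symm (ih _ _ h' h)
    | trans x y z _ _ ih ih' =>
      intro d d' h h'
      obtain ⟨d'', h''⟩ := hs y
      exact t.trans (ih _ _ h h'') (ih' _ _ h'' h')
  refine Nat.card_eq_of_bijective (Quotient.lift (fun d => Quotient.mk (linkSetoid ends _) (att d))
    fun d d' h => Quotient.sound (hlift d d' h)) ⟨?_, ?_⟩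
  · rintro ⟨d⟩ ⟨d'⟩ h
    exact Quotient.sound (hinj _ _ (Quotient.exact h) _ _ rfl rfl)
  · rintro ⟨v⟩
    obtain ⟨d, rfl⟩ := hs v
    exact ⟨⟦d⟧, rfl⟩

end Embedding

theorem partialDual_empty (G : RibbonGraph E) : G.partialDual ∅ = G := by
  simp [partialDual, flip_empty]

/-- Euler's formula for all spanning subgraphs of a plane graph. -/
theorem numBoundary_of_isPlanar [Fintype E] (hG : G.IsEmbeddingOf ends) (hp : G.IsPlanar)
    (B : Finset E) :
    (G.numBoundary B : ℝ) = 2 * numComp ends B + B.card - Nat.card V := by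
  classical
  obtain ⟨att, hs, hc, he⟩ := hG
  have : Finite V := Finite.of_surjective att hs
  have hv := numVertices_eq_card hs hc
  have hC := numComponents_partialDual hs hc he ∅
  rw [partialDual_empty] at hC
  -- The one-ribbon inequality summed over the ribbons of `C`. It is used from `∅` to `B` and from
  -- `B` to all ribbons; planarity says that the sum of the two inequalities is an equality, so each
  -- of them is.
  have step : ∀ A C : Finset E, Disjoint A C →
      G.numBoundary (C ∪ A) + 2 * numComp ends A ≤
        G.numBoundary A + 2 * numComp ends (C ∪ A) + C.card := by
    intro A C
    induction C using Finset.induction_on with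
    | empty => intro _; simp
    | insert e C heC ih =>
      intro hd
      rw [Finset.disjoint_insert_right] at hd
      have h1 := ih hd.2
      have h2 := numBoundary_insert_le hc he (B := C ∪ A) (e := e) (by simp [heC, hd.1])
      rw [Finset.insert_union, Finset.card_insert_of_notMem heC]
      omega
  have h0 : G.numBoundary ∅ = Nat.card V := by rw [numBoundary, flip_empty, mul_one]; exact hv
  have h1 := step ∅ B (Finset.disjoint_empty_left _)
  have h2 := step B Bᶜ disjoint_compl_right
  rw [Finset.union_empty, numComp_empty, h0] at h1
  rw [Finset.union_comm, Finset.union_compl, Finset.card_compl] at h2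
  rw [IsPlanar, genus, hC, hv, numFaces] at hp
  have hB := B.card_le_univ
  zify [hB] at h1 h2
  have h1' : (G.numBoundary B : ℝ) + 2 * Nat.card V ≤
    Nat.card V + 2 * numComp ends B + B.card := by exact_mod_cast h1
  have h2' : (G.numBoundary Finset.univ : ℝ) + 2 * numComp ends B ≤
    G.numBoundary B + 2 * numComp ends Finset.univ + (Fintype.card E - B.card) := by
      exact_mod_cast h2
  linarith

/-- The dual has the boundary components of `A` as vertices and, because `flip A * flip univ = flip
Aᶜ`, those of `Aᶜ` as faces. In Euler's formula the terms |A| + |Aᶜ| cancel against the number of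
edges. -/
theorem genus_partialDual [Fintype E] [DecidableEq E] (hG : G.IsEmbeddingOf ends)
    (hp : G.IsPlanar) (A : Finset E) :
    (G.partialDual A).genus =
      numComp ends Finset.univ + Nat.card V - numComp ends A - numComp ends Aᶜ := by
  have h1 := numBoundary_of_isPlanar hG hp A
  have h2 := numBoundary_of_isPlanar hG hp Aᶜ
  obtain ⟨att, hs, hc, he⟩ := hG
  have hv : (G.partialDual A).numVertices = G.numBoundary A := rfl
  have hf : (G.partialDual A).numFaces = G.numBoundary Aᶜ := by
    rw [numFaces, numBoundary, partialDual, mul_assoc, flip_mul_flip_univ, numBoundary]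
  rw [genus, numComponents_partialDual hs hc he, hv, hf, h1, h2, Finset.card_compl,
    Nat.cast_sub A.card_le_univ]
  ring

end RibbonGraph

/-! ### The rank of an edge set of the fan by a sweep along the path -/

section FanRank

variable {n : ℕ}

/-- `k` is the current end of a left-to-right sweep along the path: the Boolean `h` tells whether
`path k` is linked to the hub by the edges in `B`, the number `r` is the rank of `B`, and `B`
contains no edge at the vertices beyond `k`. -/
structure FanSweep (B : Finset (FanEdge n)) (k : Fin (n + 2)) (h : Bool) (r : ℕ) : Prop where
  link : linkSetoid (fanEnds n) B .hub (.path k) ↔ h = true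
  rank : numComp (fanEnds n) B + r = Nat.card (FanVertex n)
  isolated : ∀ j, k < j → ∀ y, linkSetoid (fanEnds n) B (.path j) y → y = .path j

instance : Finite (FanVertex n) :=
  Finite.of_surjective (fun x : Option (Fin (n + 2)) => x.elim FanVertex.hub FanVertex.path) (by
    rintro (_ | i)
    · exact ⟨none, rfl⟩
    · exact ⟨some i, rfl⟩)

namespace FanSweep

theorem empty : FanSweep (∅ : Finset (FanEdge n)) 0 false 0 where
  link := by rw [linkSetoid_empty]; simp
  rank := by rw [numComp_empty]; rfl
  isolated := by
    intro j _ y h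
    rw [linkSetoid_empty] at h
    exact h.symm

variable {B : Finset (FanEdge n)} {r : ℕ} {h : Bool}

theorem skip_rim {k : Fin (n + 1)} (hB : FanSweep B k.castSucc h r) :
    FanSweep B k.succ false r where
  link := by
    simp only [Bool.false_eq_true, iff_false]
    intro h
    cases hB.isolated k.succ Fin.castSucc_lt_succ _ (Setoid.symm' _ h)
  rank := hB.rank
  isolated := fun j hj => hB.isolated j (Fin.castSucc_lt_succ.trans hj)

variable [DecidableEq (FanEdge n)]

/-- Stated for any edge from the hub to `path k`, so that it also covers the two extra spokes. The
rank grows exactly when `path k` was not yet linked to the hub. -/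
theorem insert_spoke {k : Fin (n + 2)} (hB : FanSweep B k h r) {e : FanEdge n}
    (he : fanEnds n e = s(.hub, .path k)) : FanSweep (insert e B) k true (r + (!h).toNat) where
  link := by simpa using linkSetoid_of_mem (Finset.mem_insert_self _ _) he
  rank := by
    have := hB.rank
    cases h with
    | true => rw [numComp_insert_of_linked he (hB.link.2 rfl)]; simpa using this
    | false =>
      have h1 := numComp_insert_of_not_linked he (fun h => by simpa using hB.link.1 h)
      simp only [Bool.not_false, Bool.toNat_true]
      omega
  isolated := by
    intro j hj y hy
    rw [linkSetoid_insert he] at hy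
    rcases hy with h | ⟨h, -⟩ | ⟨h, -⟩
    · exact hB.isolated j hj y h
    · cases hB.isolated j hj _ h
    · cases hB.isolated j hj _ h; exact absurd hj (lt_irrefl _)

/-- The new vertex is still isolated, so the rim edge always raises the rank and passes on the link
to the hub. -/
theorem insert_rim {k : Fin (n + 1)} (hB : FanSweep B k.castSucc h r) :
    FanSweep (insert (.rim k) B) k.succ h (r + 1) := by
  have he : fanEnds n (.rim k) = s(.path k.castSucc, .path k.succ) := rfl
  have hk := hB.isolated k.succ Fin.castSucc_lt_succ
  refine ⟨?_, ?_, ?_⟩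
  · rw [linkSetoid_insert he, ← hB.link]
    constructor
    · rintro (h | ⟨h, -⟩ | ⟨h, -⟩)
      · cases hk _ (Setoid.symm' _ h)
      · exact h
      · cases hk _ (Setoid.symm' _ h)
    · exact fun h => Or.inr (Or.inl ⟨h, Setoid.refl' _ _⟩)
  · have h1 := numComp_insert_of_not_linked he fun h => by
      have := hk _ (Setoid.symm' _ h)
      simp [Fin.ext_iff] at this
    have := hB.rank
    omega
  · intro j hj y hy
    have hj' := Fin.castSucc_lt_succ.trans hj
    rw [linkSetoid_insert he] at hy
    rcases hy with h | ⟨h, -⟩ | ⟨h, -⟩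
    · exact hB.isolated j hj' y h
    · cases hB.isolated j hj' _ h; exact absurd hj' (lt_irrefl _)
    · cases hB.isolated j hj' _ h; exact absurd hj (lt_irrefl _)

end FanSweep

/-- The sweep passes a rim edge (present if `x.1`) and then a spoke (present if `x.2`). -/
def rankStep (q : Bool × ℕ) (x : Bool × Bool) : Bool × ℕ :=
  ((q.1 && x.1) || x.2, q.2 + x.1.toNat + (x.2 && !(q.1 && x.1)).toNat)

def rankRun (q : Bool × ℕ) : (m : ℕ) → (Fin m → Bool × Bool) → Bool × ℕ
  | 0, _ => q
  | m + 1, w => rankStep (rankRun q m (Fin.init w)) (w (Fin.last m))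

/-- An edge set of the fan: the two spokes at the first vertex, the second spoke at the last vertex,
and the pairs formed by a rim edge and the spoke following it. -/
abbrev FanCode (n : ℕ) : Type := (Bool × Bool) × Bool × (Fin (n + 1) → Bool × Bool)

def codeRank (c : FanCode n) : ℕ :=
  let q := rankRun (c.1.1 || c.1.2, (c.1.1 || c.1.2).toNat) (n + 1) c.2.2
  q.2 + (c.2.1 && !q.1).toNat

def codeCompl (c : FanCode n) : FanCode n :=
  ((!c.1.1, !c.1.2), !c.2.1, fun i => (!(c.2.2 i).1, !(c.2.2 i).2))

open Classical in
/-- The encoding of edge sets. -/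
noncomputable def fanCode (n : ℕ) : Finset (FanEdge n) ≃ FanCode n where
  toFun A := ((decide (.spoke 0 ∈ A), decide (.extraFirst ∈ A)), decide (.extraLast ∈ A),
    fun i => (decide (.rim i ∈ A), decide (.spoke i.succ ∈ A)))
  invFun c := Finset.univ.filter fun
    | .rim i => (c.2.2 i).1 = true
    | .spoke i => Fin.cases c.1.1 (fun j => (c.2.2 j).2) i = true
    | .extraFirst => c.1.2 = true
    | .extraLast => c.2.1 = true
  left_inv A := by
    ext (i | i | _ | _)
    · simp
    · refine Fin.cases ?_ (fun j => ?_) i <;> simp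
    · simp
    · simp
  right_inv c := by simp

theorem fanCode_compl [DecidableEq (FanEdge n)] (A : Finset (FanEdge n)) :
    fanCode n Aᶜ = codeCompl (fanCode n A) := by
  simp [fanCode, codeCompl]
  congr!

/-- The position in the sweep at which an edge is passed. -/
def fanLevel : FanEdge n → ℕ
  | .rim i => i + 1
  | .spoke i => i
  | .extraFirst => 0
  | .extraLast => n + 2

theorem exists_fanSweep (A : Finset (FanEdge n)) (m : ℕ) (hm : m ≤ n + 1) :
    ∃ B : Finset (FanEdge n), (∀ e, e ∈ B ↔ e ∈ A ∧ fanLevel e ≤ m) ∧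
      let c := fanCode n A
      let q := rankRun (c.1.1 || c.1.2, (c.1.1 || c.1.2).toNat) m (fun i => c.2.2 (i.castLE hm))
      FanSweep B ⟨m, by omega⟩ q.1 q.2 := by
  classical
  induction m with
  | zero =>
    refine ⟨A.filter fun e => fanLevel e ≤ 0, by simp, ?_⟩
    have hmem : ∀ e : FanEdge n, fanLevel e ≤ 0 ↔ e = .spoke 0 ∨ e = .extraFirst := by
      rintro (i | i | _ | _) <;> simp [fanLevel]
    have hs : fanEnds n (.spoke 0) = s(.hub, .path 0) := rfl
    have hx : fanEnds n .extraFirst = s(.hub, .path 0) := rfl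
    have hA : A.filter (fun e => fanLevel e ≤ 0) =
        (if .extraFirst ∈ A then {.extraFirst} else ∅) ∪ (if .spoke 0 ∈ A then {.spoke 0} else ∅) := by
      ext e
      simp only [Finset.mem_filter, hmem]
      split_ifs <;> simp <;> grind
    have h0 := FanSweep.empty (n := n)
    rw [hA]
    by_cases h1 : (.spoke 0) ∈ A <;> by_cases h2 : (.extraFirst) ∈ A <;>
      simp only [h1, h2, if_true, if_false, Finset.empty_union, Finset.union_empty, rankRun,
        fanCode, Equiv.coe_fn_mk, decide_true, decide_false]
    · simpa using (h0.insert_spoke hs).insert_spoke hx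
    · simpa using h0.insert_spoke hs
    · simpa using h0.insert_spoke hx
    · simpa using h0
  | succ m ih =>
    obtain ⟨B, hB, hS⟩ := ih (by omega)
    set c := fanCode n A with hc
    set q := rankRun (c.1.1 || c.1.2, (c.1.1 || c.1.2).toNat) m
      (fun i => c.2.2 (i.castLE (by omega : m ≤ n + 1))) with hq
    let k : Fin (n + 1) := ⟨m, by omega⟩
    have hk1 : (c.2.2 k).1 = decide (FanEdge.rim k ∈ A) := rfl
    have hk2 : (c.2.2 k).2 = decide (FanEdge.spoke k.succ ∈ A) := rfl
    have hlevel : ∀ e : FanEdge n, fanLevel e ≤ m + 1 ↔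
        fanLevel e ≤ m ∨ e = .rim k ∨ e = .spoke k.succ := by
      rintro (i | i | _ | _) <;> simp [fanLevel, Fin.ext_iff, k] <;> omega
    -- Level `m + 1` is passed in two stages, the rim edge before the spoke, matching `rankStep`.
    obtain ⟨B₁, hB₁, hS₁⟩ : ∃ B₁ : Finset (FanEdge n),
        (∀ e, e ∈ B₁ ↔ e ∈ B ∨ e ∈ A ∧ e = .rim k) ∧
        FanSweep B₁ k.succ (q.1 && (c.2.2 k).1) (q.2 + (c.2.2 k).1.toNat) := by
      by_cases h : FanEdge.rim k ∈ A
      · refine ⟨insert (.rim k) B, fun e => by simp only [Finset.mem_insert]; grind, ?_⟩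
        rw [hk1, decide_eq_true h]
        simpa using FanSweep.insert_rim (k := k) hS
      · refine ⟨B, fun e => by grind, ?_⟩
        rw [hk1, decide_eq_false h]
        simpa using FanSweep.skip_rim (k := k) hS
    obtain ⟨B₂, hB₂, hS₂⟩ : ∃ B₂ : Finset (FanEdge n),
        (∀ e, e ∈ B₂ ↔ e ∈ B₁ ∨ e ∈ A ∧ e = .spoke k.succ) ∧
        FanSweep B₂ k.succ (rankStep q (c.2.2 k)).1 (rankStep q (c.2.2 k)).2 := by
      rw [rankStep]
      by_cases h : FanEdge.spoke k.succ ∈ A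
      · refine ⟨insert (.spoke k.succ) B₁, fun e => by simp only [Finset.mem_insert]; grind, ?_⟩
        rw [hk2, decide_eq_true h]
        simpa using hS₁.insert_spoke (e := .spoke k.succ) rfl
      · refine ⟨B₁, fun e => by grind, ?_⟩
        rw [hk2, decide_eq_false h]
        simpa using hS₁
    exact ⟨B₂, fun e => by rw [hB₂, hB₁, hB, hlevel]; tauto, hS₂⟩

theorem numComp_add_codeRank (A : Finset (FanEdge n)) :
    numComp (fanEnds n) A + codeRank (fanCode n A) = Nat.card (FanVertex n) := by
  classical
  obtain ⟨B, hB, hS⟩ := exists_fanSweep A (n + 1) le_rfl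
  have hlevel : ∀ e : FanEdge n, e = .extraLast ∨ fanLevel e ≤ n + 1 := by
    rintro (i | i | _ | _) <;> simp [fanLevel] <;> omega
  by_cases h : FanEdge.extraLast ∈ A
  · have hA : A = insert .extraLast B := by
      ext e
      rw [Finset.mem_insert, hB]
      rcases hlevel e with rfl | h' <;> grind
    have h1 : (fanCode n A).2.1 = true := decide_eq_true h
    have := (hS.insert_spoke (e := .extraLast) rfl).rank
    rw [← hA] at this
    rw [codeRank, h1]
    exact this
  · have hA : A = B := by
      ext e
      rw [hB]
      rcases hlevel e with rfl | h'
      · simp [h]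
      · simp [h']
    have h1 : (fanCode n A).2.1 = false := decide_eq_false h
    have := hS.rank
    rw [← hA] at this
    rw [codeRank, h1]
    simpa using this

theorem codeRank_univ : codeRank (fanCode n Finset.univ) = n + 2 := by
  have key : ∀ m, rankRun (true, 1) m (fun _ => (true, true)) = (true, m + 1) := by
    intro m
    induction m with
    | zero => rfl
    | succ m ih =>
      rw [rankRun]
      change rankStep (rankRun _ m fun _ => (true, true)) _ = _
      rw [ih]
      simp [rankStep]
  simp [codeRank, fanCode, key]

/-- This is γ = r(A) + r(Aᶜ) - r(E), where r(E) = n + 2 comes from `codeRank_univ`. -/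
theorem genus_partialDual_fan {G : RibbonGraph (FanEdge n)} (hG : G.IsEmbeddingOf (fanEnds n))
    (hp : G.IsPlanar) (A : Finset (FanEdge n)) :
    (G.partialDual A).genus =
      ((codeRank (fanCode n A) + codeRank (codeCompl (fanCode n A)) : ℕ) : ℝ) - (n + 2) := by
  classical
  have h1 := numComp_add_codeRank A
  have h2 := numComp_add_codeRank Aᶜ
  have h3 := numComp_add_codeRank (Finset.univ : Finset (FanEdge n))
  rw [codeRank_univ] at h3
  rw [fanCode_compl] at h2
  rw [RibbonGraph.genus_partialDual hG hp, ← h3]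
  have h1' : (numComp (fanEnds n) A : ℝ) + codeRank (fanCode n A) =
    numComp (fanEnds n) Finset.univ + (n + 2) := by rw [← h3] at h1; exact_mod_cast h1
  have h2' : (numComp (fanEnds n) Aᶜ : ℝ) + codeRank (codeCompl (fanCode n A)) =
    numComp (fanEnds n) Finset.univ + (n + 2) := by rw [← h3] at h2; exact_mod_cast h2
  push_cast
  linarith

theorem card_fanEdge : Fintype.card (FanEdge n) = 2 * n + 5 := by
  have h := Fintype.card_congr (fanCode n)
  rw [Fintype.card_finset] at h
  simp only [Fintype.card_prod, Fintype.card_bool, Fintype.card_fun, Fintype.card_fin] at h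
  apply Nat.pow_right_injective le_rfl
  simp only [h]
  rw [show 2 * 2 = 2 ^ 2 from rfl, ← pow_mul]
  ring

end FanRank

/-! ### The two-colour sweep as a Markov chain -/

section FanWalk

variable {K : Type*} [Field K]

/-- The averaging operator of the walk on the pairs (whether the current vertex is linked to the
hub by edges of both colours, sum of the two ranks). -/
def walkOp (K : Type*) [Field K] : ((Bool × ℕ) → K) →ₗ[K] ((Bool × ℕ) → K) where
  toFun g := fun
    | (false, c) => (g (false, c + 1) + 2 * g (false, c + 2) + g (true, c + 2)) / 4
    | (true, c) => (g (false, c + 1) + g (true, c + 2)) / 2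
  map_add' g g' := by ext ⟨_ | _, c⟩ <;> simp only [Pi.add_apply] <;> ring
  map_smul' a g := by ext ⟨_ | _, c⟩ <;> simp only [Pi.smul_apply, smul_eq_mul, RingHom.id_apply] <;> ring

/-- The expectation after `m` steps of the walk. -/
def walkMean (K : Type*) [Field K] (m : ℕ) : ((Bool × ℕ) → K) →ₗ[K] K :=
  ((2 : K)⁻¹ • (LinearMap.proj (R := K) (φ := fun _ : Bool × ℕ => K) (false, 1) +
    LinearMap.proj (true, 2))) ∘ₗ (walkOp K ^ m)

theorem walkMean_zero (g : Bool × ℕ → K) : walkMean K 0 g = (g (false, 1) + g (true, 2)) / 2 := by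
  simp [walkMean, div_eq_inv_mul, mul_add]

theorem walkMean_succ (m : ℕ) (g : Bool × ℕ → K) :
    walkMean K (m + 1) g = walkMean K m (walkOp K g) := by
  simp [walkMean, pow_succ]

variable [CharZero K]

/-- The contribution of the second spoke at the last vertex of the fan. -/
def lastSpoke (f : ℕ → K) : Bool × ℕ → K
  | (false, c) => (f c + f (c + 1)) / 2
  | (true, c) => f c

/-- Loses nothing that matters when at least one colour is linked: `false` then means exactly one,
and the colours play symmetric roles. -/
def bothColours (q q' : Bool × ℕ) : Bool × ℕ := (q.1 && q'.1, q.2 + q'.2)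

def negPair (x : Bool × Bool) : Bool × Bool := (!x.1, !x.2)

theorem sum_rankStep (q q' : Bool × ℕ) (hq : (q.1 || q'.1) = true) (g : Bool × ℕ → K) :
    ∑ x : Bool × Bool, g (bothColours (rankStep q x) (rankStep q' (negPair x))) =
      4 * walkOp K g (bothColours q q') := by
  obtain ⟨h, c⟩ := q
  obtain ⟨h', c'⟩ := q'
  rw [Fintype.sum_prod_type]
  simp only [Fintype.sum_bool]
  cases h <;> cases h' <;> simp at hq <;>
    simp [bothColours, rankStep, negPair, walkOp, add_assoc, add_left_comm, add_comm] <;> ring_nf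

/-- The last spoke belongs to one of the two colours and links the current vertex to the hub in that
colour. -/
theorem rankRun_or (q q' : Bool × ℕ) (hq : (q.1 || q'.1) = true) (m : ℕ)
    (w : Fin m → Bool × Bool) :
    ((rankRun q m w).1 || (rankRun q' m (negPair ∘ w)).1) = true := by
  cases m with
  | zero => exact hq
  | succ m =>
    simp only [rankRun, rankStep, negPair, Function.comp]
    cases (w (Fin.last m)).2 <;> simp

/-- Summing out the last letter first replaces `g` by `4 * walkOp K g`, hence the induction over all
`g`. -/
theorem sum_rankRun (q q' : Bool × ℕ) (hq : (q.1 || q'.1) = true) (m : ℕ) (g : Bool × ℕ → K) :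
    ∑ w : Fin m → Bool × Bool, g (bothColours (rankRun q m w) (rankRun q' m (negPair ∘ w))) =
      4 ^ m * (walkOp K ^ m) g (bothColours q q') := by
  induction m generalizing g with
  | zero => simp [rankRun]
  | succ m ih =>
    rw [← (Fin.snocEquiv fun _ => Bool × Bool).sum_comp, Fintype.sum_prod_type_right]
    have : ∀ w : Fin m → Bool × Bool, ∑ x : Bool × Bool,
        g (bothColours (rankRun q (m + 1) (Fin.snocEquiv (fun _ => Bool × Bool) (x, w)))
          (rankRun q' (m + 1) (negPair ∘ Fin.snocEquiv (fun _ => Bool × Bool) (x, w)))) =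
        4 * walkOp K g (bothColours (rankRun q m w) (rankRun q' m (negPair ∘ w))) := by
      intro w
      rw [← sum_rankStep _ _ (rankRun_or q q' hq m w)]
      refine Finset.sum_congr rfl fun x _ => ?_
      have h1 : Fin.init (Fin.snocEquiv (fun _ => Bool × Bool) (x, w)) = w :=
        Fin.init_snoc (α := fun _ => Bool × Bool) x w
      have h2 : Fin.snocEquiv (fun _ => Bool × Bool) (x, w) (Fin.last m) = x :=
        Fin.snoc_last (α := fun _ => Bool × Bool) x w
      have h3 : Fin.init (negPair ∘ Fin.snocEquiv (fun _ => Bool × Bool) (x, w)) = negPair ∘ w := by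
        conv_rhs => rw [← h1]
        rfl
      rw [rankRun, rankRun, h1, h3, Function.comp_apply, h2]
    simp only [this]
    rw [← Finset.mul_sum, ih, pow_succ, pow_succ]
    simp only [Module.End.mul_apply]
    ring

theorem sum_lastSpoke (q q' : Bool × ℕ) (hq : (q.1 || q'.1) = true) (f : ℕ → K) :
    ∑ x : Bool, f (q.2 + (x && !q.1).toNat + (q'.2 + (!x && !q'.1).toNat)) =
      2 * lastSpoke f (bothColours q q') := by
  obtain ⟨h, c⟩ := q
  obtain ⟨h', c'⟩ := q'
  simp only [Fintype.sum_bool]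
  cases h <;> cases h' <;> simp at hq <;>
    simp [bothColours, lastSpoke, add_assoc, add_comm, add_left_comm] <;> ring_nf

/-- Of the four colourings of the two first spokes, two are monochromatic and start at `(false, 1)`,
two are mixed and start at `(true, 2)`; this is the initial law in `walkMean`. -/
theorem sum_codeRank (n : ℕ) (f : ℕ → K) :
    ∑ c : FanCode n, f (codeRank c + codeRank (codeCompl c)) =
      2 ^ (2 * n + 5) * walkMean K (n + 1) (lastSpoke f) := by
  rw [Fintype.sum_prod_type]
  have key : ∀ x : Bool × Bool, ∑ y : Bool × (Fin (n + 1) → Bool × Bool),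
      f (codeRank (x, y) + codeRank (codeCompl (x, y))) =
      2 * (4 ^ (n + 1) * (walkOp K ^ (n + 1)) (lastSpoke f)
        (bothColours (x.1 || x.2, (x.1 || x.2).toNat) (!x.1 || !x.2, (!x.1 || !x.2).toNat))) := by
    intro x
    have hx : ((x.1 || x.2) || (!x.1 || !x.2)) = true := by
      obtain ⟨_ | _, _ | _⟩ := x <;> rfl
    rw [Fintype.sum_prod_type_right, ← sum_rankRun _ _ hx, Finset.mul_sum]
    refine Finset.sum_congr rfl fun w _ => ?_
    rw [← sum_lastSpoke _ _ (rankRun_or _ _ hx _ w)]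
    rfl
  simp only [key]
  rw [Fintype.sum_prod_type]
  simp only [Fintype.sum_bool, walkMean]
  simp [bothColours]
  rw [show (2 : K) ^ (2 * n + 5) = 8 * 4 ^ (n + 1) by
    rw [show (4 : K) = 2 ^ 2 by norm_num, ← pow_mul]; ring]
  ring

end FanWalk

theorem integral_pdLaw {K : Type*} [RCLike K] {n : ℕ} {G : RibbonGraph (FanEdge n)}
    (hG : G.IsEmbeddingOf (fanEnds n)) (hp : G.IsPlanar) (f : ℝ → K) :
    ∫ y, f y ∂G.pdLaw = walkMean K (n + 1) (lastSpoke fun c => f (c - (n + 2))) := by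
  rw [RibbonGraph.pdLaw, integral_smul_measure,
    integral_finsetSum_measure fun A _ => integrable_dirac (by simp)]
  simp only [integral_dirac, genus_partialDual_fan hG hp]
  rw [(fanCode n).sum_comp fun c => f ((codeRank c + codeRank (codeCompl c) : ℕ) - (n + 2)),
    sum_codeRank n fun c => f (c - (n + 2)), card_fanEdge]
  rw [RCLike.real_smul_eq_coe_mul, ← mul_assoc]
  simp only [ENNReal.toReal_inv, ENNReal.toReal_pow, ENNReal.toReal_ofNat, RCLike.ofReal_inv,
    RCLike.ofReal_pow, RCLike.ofReal_ofNat]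
  rw [inv_mul_cancel₀ (by simp), one_mul]

/-! ### Exact mean and variance -/

section Moments

theorem walkMean_const_one (m : ℕ) : walkMean ℝ m (fun _ => 1) = 1 := by
  induction m with
  | zero => rw [walkMean_zero]; norm_num
  | succ m ih =>
    have : walkOp ℝ (fun _ => 1) = fun _ => 1 := by
      ext ⟨_ | _, c⟩ <;> norm_num [walkOp]
    rw [walkMean_succ, this, ih]

/-- The closed forms here and below solve the linear recurrences given by `walkOp` on the span of 1,
the indicator of `true`, the counter, their product and the squared counter. The number 1/4 is the
second eigenvalue of the two-state chain, and 1/3 the stationary weight of `true`. -/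
theorem walkMean_both (m : ℕ) :
    walkMean ℝ m (fun q => if q.1 then 1 else 0) = 1 / 3 + (1 / 4) ^ m / 6 := by
  induction m with
  | zero => rw [walkMean_zero]; norm_num
  | succ m ih =>
    have : walkOp ℝ (fun q => if q.1 then 1 else 0) =
        (1 / 4 : ℝ) • (fun _ => 1) + (1 / 4 : ℝ) • fun q => if q.1 then 1 else 0 := by
      ext ⟨_ | _, c⟩ <;> norm_num [walkOp]
    rw [walkMean_succ, this]
    simp only [map_add, map_smul, ih, walkMean_const_one, smul_eq_mul]
    ring

theorem walkMean_count (m : ℕ) :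
    walkMean ℝ m (fun q => (q.2 : ℝ)) = 13 / 9 + 5 / 3 * m + (1 / 4) ^ m / 18 := by
  induction m with
  | zero => rw [walkMean_zero]; norm_num
  | succ m ih =>
    have : walkOp ℝ (fun q => (q.2 : ℝ)) =
        (fun q => (q.2 : ℝ)) + (7 / 4 : ℝ) • (fun _ => 1) -
          (1 / 4 : ℝ) • fun q => if q.1 then 1 else 0 := by
      ext ⟨_ | _, c⟩ <;> simp [walkOp] <;> ring
    rw [walkMean_succ, this]
    simp only [map_add, map_sub, map_smul, ih, walkMean_const_one, walkMean_both, smul_eq_mul]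
    push_cast
    ring

theorem walkMean_count_both (m : ℕ) :
    walkMean ℝ m (fun q => if q.1 then (q.2 : ℝ) else 0) =
      17 / 27 + 5 / 9 * m + (10 / 27 + 7 / 18 * m) * (1 / 4) ^ m := by
  induction m with
  | zero => rw [walkMean_zero]; norm_num
  | succ m ih =>
    have : walkOp ℝ (fun q => if q.1 then (q.2 : ℝ) else 0) =
        (1 / 4 : ℝ) • (fun q => (q.2 : ℝ)) + (1 / 2 : ℝ) • (fun _ => 1) +
          (1 / 4 : ℝ) • (fun q => if q.1 then (q.2 : ℝ) else 0) +
          (1 / 2 : ℝ) • fun q => if q.1 then 1 else 0 := by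
      ext ⟨_ | _, c⟩ <;> simp [walkOp] <;> ring
    rw [walkMean_succ, this]
    simp only [map_add, map_smul, ih, walkMean_const_one, walkMean_both, walkMean_count,
      smul_eq_mul]
    push_cast
    ring

theorem walkMean_count_sq (m : ℕ) :
    walkMean ℝ m (fun q => (q.2 : ℝ) ^ 2) =
      61 / 27 + 134 / 27 * m + 25 / 9 * m ^ 2 + (13 / 54 + 7 / 27 * m) * (1 / 4) ^ m := by
  induction m with
  | zero => rw [walkMean_zero]; norm_num
  | succ m ih =>
    have : walkOp ℝ (fun q => (q.2 : ℝ) ^ 2) =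
        (fun q => (q.2 : ℝ) ^ 2) + (7 / 2 : ℝ) • (fun q => (q.2 : ℝ)) -
          (1 / 2 : ℝ) • (fun q => if q.1 then (q.2 : ℝ) else 0) + (13 / 4 : ℝ) • (fun _ => 1) -
          (3 / 4 : ℝ) • fun q => if q.1 then 1 else 0 := by
      ext ⟨_ | _, c⟩ <;> simp [walkOp] <;> ring
    rw [walkMean_succ, this]
    simp only [map_add, map_sub, map_smul, ih, walkMean_const_one, walkMean_both, walkMean_count,
      walkMean_count_both, smul_eq_mul]
    push_cast
    ring

variable {n : ℕ} {G : RibbonGraph (FanEdge n)}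

theorem pdMean_fan (hG : G.IsEmbeddingOf (fanEnds n)) (hp : G.IsPlanar) :
    G.pdMean = 2 / 3 * n + 13 / 9 - (1 / 4) ^ (n + 1) / 36 := by
  have : lastSpoke (fun c : ℕ => (c : ℝ) - (n + 2)) =
      (fun q => (q.2 : ℝ)) + (1 / 2 - (n + 2) : ℝ) • (fun _ => 1) -
        (1 / 2 : ℝ) • fun q => if q.1 then 1 else 0 := by
    ext ⟨_ | _, c⟩ <;> simp [lastSpoke] <;> ring
  rw [RibbonGraph.pdMean, integral_pdLaw hG hp, this]
  simp only [map_add, map_sub, map_smul, walkMean_const_one, walkMean_both, walkMean_count,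
    smul_eq_mul]
  push_cast
  ring

theorem pdVariance_fan (hG : G.IsEmbeddingOf (fanEnds n)) (hp : G.IsPlanar) :
    G.pdVariance = 4 / 27 * n + 32 / 81 - (31 / 324 + n / 27) * (1 / 4) ^ (n + 1)
      - ((1 / 4) ^ (n + 1)) ^ 2 / 1296 := by
  have key : ∀ N : ℝ, lastSpoke (fun c : ℕ => ((c : ℝ) - N) ^ 2) =
      (fun q => (q.2 : ℝ) ^ 2) + (1 - 2 * N) • (fun q => (q.2 : ℝ)) +
        (N ^ 2 - N + 1 / 2) • (fun _ => 1) - (fun q => if q.1 then (q.2 : ℝ) else 0) +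
        (N - 1 / 2) • fun q => if q.1 then 1 else 0 := by
    intro N
    ext ⟨_ | _, c⟩ <;> simp [lastSpoke] <;> ring
  rw [RibbonGraph.pdVariance, variance_eq_integral aemeasurable_id]
  have hm : ∫ y, id y ∂G.pdLaw = 2 / 3 * n + 13 / 9 - (1 / 4) ^ (n + 1) / 36 := pdMean_fan hG hp
  rw [hm, integral_pdLaw hG hp]
  -- Here `N` is n + 2 plus the mean, so the shift and the centring are treated together.
  simp only [id, sub_sub, key]
  simp only [map_add, map_sub, map_smul, walkMean_const_one, walkMean_both, walkMean_count,
    walkMean_count_both, walkMean_count_sq, smul_eq_mul]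
  push_cast
  ring

end Moments

/-! ### Perturbed eigenvalue and characteristic function -/

section CharFun

theorem norm_walkOp_le {g : Bool × ℕ → ℂ} {M : ℝ} (h : ∀ q, ‖g q‖ ≤ M) (q : Bool × ℕ) :
    ‖walkOp ℂ g q‖ ≤ M := by
  obtain ⟨_ | _, c⟩ := q
  · change ‖(g (false, c + 1) + 2 * g (false, c + 2) + g (true, c + 2)) / 4‖ ≤ M
    have h1 := norm_add₃_le (a := g (false, c + 1)) (b := 2 * g (false, c + 2))
      (c := g (true, c + 2))
    rw [norm_mul, Complex.norm_ofNat] at h1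
    rw [norm_div, Complex.norm_ofNat, div_le_iff₀ (by norm_num)]
    linarith [h (false, c + 1), h (false, c + 2), h (true, c + 2)]
  · change ‖(g (false, c + 1) + g (true, c + 2)) / 2‖ ≤ M
    have h1 := norm_add_le (g (false, c + 1)) (g (true, c + 2))
    rw [norm_div, Complex.norm_ofNat, div_le_iff₀ (by norm_num)]
    linarith [h (false, c + 1), h (true, c + 2)]

theorem norm_walkOp_pow_le {g : Bool × ℕ → ℂ} {M : ℝ} (h : ∀ q, ‖g q‖ ≤ M) (m : ℕ)
    (q : Bool × ℕ) : ‖(walkOp ℂ ^ m) g q‖ ≤ M := by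
  induction m generalizing g with
  | zero => exact h q
  | succ m ih => rw [pow_succ]; exact ih (norm_walkOp_le h)

/-- Averaging does not increase the sup norm, so the defects of an approximate eigenvector add up at
most linearly in the number of steps. -/
theorem norm_walkOp_pow_sub_le {g : Bool × ℕ → ℂ} {r : ℂ} {δ : ℝ} (hr : ‖r‖ ≤ 1)
    (h : ∀ q, ‖walkOp ℂ g q - r * g q‖ ≤ δ) (m : ℕ) (q : Bool × ℕ) :
    ‖(walkOp ℂ ^ m) g q - r ^ m * g q‖ ≤ m * δ := by
  induction m with
  | zero => simp
  | succ m ih =>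
    have h1 := norm_walkOp_pow_le (g := walkOp ℂ g - r • g) h m q
    have h2 : (walkOp ℂ ^ (m + 1)) g q - r ^ (m + 1) * g q =
        (walkOp ℂ ^ m) (walkOp ℂ g - r • g) q + r * ((walkOp ℂ ^ m) g q - r ^ m * g q) := by
      rw [pow_succ, map_sub, map_smul, Module.End.mul_apply]
      simp only [Pi.sub_apply, Pi.smul_apply, smul_eq_mul]
      ring
    rw [h2]
    refine (norm_add_le _ _).trans ?_
    rw [norm_mul]
    have h3 := mul_le_mul hr ih (norm_nonneg _) zero_le_one
    push_cast
    linarith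

theorem norm_half_add_le {a b : ℂ} {M : ℝ} (ha : ‖a‖ ≤ M) (hb : ‖b‖ ≤ M) : ‖(a + b) / 2‖ ≤ M := by
  rw [norm_div, Complex.norm_ofNat, div_le_iff₀ (by norm_num)]
  linarith [norm_add_le a b]

theorem walkMean_eq (m : ℕ) (g : Bool × ℕ → ℂ) :
    walkMean ℂ m g = ((walkOp ℂ ^ m) g (false, 1) + (walkOp ℂ ^ m) g (true, 2)) / 2 := by
  simp [walkMean, div_eq_inv_mul, mul_add]

theorem norm_walkMean_le {g : Bool × ℕ → ℂ} {M : ℝ} (h : ∀ q, ‖g q‖ ≤ M) (m : ℕ) :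
    ‖walkMean ℂ m g‖ ≤ M := by
  rw [walkMean_eq]
  exact norm_half_add_le (norm_walkOp_pow_le h m _) (norm_walkOp_pow_le h m _)

theorem norm_walkMean_sub_le {g : Bool × ℕ → ℂ} {r : ℂ} {δ : ℝ} (hr : ‖r‖ ≤ 1)
    (h : ∀ q, ‖walkOp ℂ g q - r * g q‖ ≤ δ) (m : ℕ) :
    ‖walkMean ℂ m g - r ^ m * ((g (false, 1) + g (true, 2)) / 2)‖ ≤ m * δ := by
  rw [walkMean_eq, mul_div_assoc', mul_add, ← sub_div, add_sub_add_comm]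
  exact norm_half_add_le (norm_walkOp_pow_sub_le hr h m _) (norm_walkOp_pow_sub_le hr h m _)

/-- The function below is nearly an eigenvector of the averaging operator. -/
theorem norm_walkMean_pow_sub_le {τ ρ : ℂ} (hτ : ‖τ‖ = 1) (hρ : ‖ρ‖ ≤ 1) (n : ℕ) :
    ‖walkMean ℂ (n + 1) (lastSpoke fun c => τ ^ c) - (τ * ρ) ^ (n + 2)‖ ≤
      ‖(1 + τ) / 2 - (2 * ρ - τ)‖ +
        (n + 1) * (‖4 * ρ ^ 2 - (1 + 4 * τ) * ρ + τ ^ 2‖ / 2) := by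
  -- The value at `false` is chosen so that the eigenvalue equation for `τ * ρ` is exact at `true`;
  -- the defect at `false` is then the characteristic polynomial 4ρ² - (1 + 4τ)ρ + τ², up to the
  -- factor -τ^(c+1)/2.
  set W : Bool × ℕ → ℂ := fun q => τ ^ q.2 * if q.1 then 1 else 2 * ρ - τ with hW
  have h1 : ∀ q, ‖(lastSpoke (fun c => τ ^ c) - W) q‖ ≤ ‖(1 + τ) / 2 - (2 * ρ - τ)‖ := by
    rintro ⟨_ | _, c⟩
    · have : (lastSpoke (fun c => τ ^ c) - W) (false, c) =
          τ ^ c * ((1 + τ) / 2 - (2 * ρ - τ)) := by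
        simp only [Pi.sub_apply, lastSpoke, hW]
        simp
        ring
      rw [this, norm_mul, norm_pow, hτ, one_pow, one_mul]
    · simp [lastSpoke, hW]
  have h2 : ∀ q, ‖walkOp ℂ W q - τ * ρ * W q‖ ≤
      ‖4 * ρ ^ 2 - (1 + 4 * τ) * ρ + τ ^ 2‖ / 2 := by
    rintro ⟨_ | _, c⟩
    · have : walkOp ℂ W (false, c) - τ * ρ * W (false, c) =
          τ ^ (c + 1) * ((4 * ρ ^ 2 - (1 + 4 * τ) * ρ + τ ^ 2) / (-2)) := by
        simp only [walkOp, LinearMap.coe_mk, AddHom.coe_mk, hW]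
        simp
        ring
      rw [this, norm_mul, norm_pow, hτ, one_pow, one_mul, norm_div]
      simp
    · have : walkOp ℂ W (true, c) - τ * ρ * W (true, c) = 0 := by
        simp only [walkOp, LinearMap.coe_mk, AddHom.coe_mk, hW]
        simp
        ring
      rw [this, norm_zero]
      positivity
  have h3 := norm_walkMean_le h1 (n + 1)
  have h4 := norm_walkMean_sub_le (by rwa [norm_mul, hτ, one_mul]) h2 (n + 1)
  -- The initial law is that of one step from `(true, 0)`, where `W` is 1, and so contributes one
  -- more factor.
  have h5 : (τ * ρ) ^ (n + 1) * ((W (false, 1) + W (true, 2)) / 2) = (τ * ρ) ^ (n + 2) := by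
    simp [hW]
    ring
  rw [h5] at h4
  rw [map_sub] at h3
  push_cast at h4
  refine le_trans ?_ (add_le_add h3 h4)
  refine le_trans (le_of_eq ?_) (norm_add_le _ _)
  congr 1
  ring

theorem norm_exp_sub_quadratic_le {x : ℂ} (hx : ‖x‖ ≤ 1) :
    ‖Complex.exp x - (1 + x + x ^ 2 / 2)‖ ≤ ‖x‖ ^ 3 := by
  have h := Complex.exp_bound hx (n := 3) (by norm_num)
  simp only [Finset.sum_range_succ, Finset.sum_range_zero] at h
  norm_num [Nat.factorial] at h
  refine h.trans ?_
  nlinarith [pow_nonneg (norm_nonneg x) 3]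

/-- The approximate dominant eigenvalue of the walk, normalised. -/
noncomputable def walkRoot (s : ℝ) : ℂ :=
  Complex.exp (2 / 3 * s * Complex.I - 2 / 27 * s ^ 2)

theorem norm_walkRoot_le (s : ℝ) : ‖walkRoot s‖ ≤ 1 := by
  rw [walkRoot, Complex.norm_exp, Real.exp_le_one_iff]
  have : (2 / 3 * (s : ℂ) * Complex.I - 2 / 27 * (s : ℂ) ^ 2) =
      ((-(2 / 27 * s ^ 2) : ℝ) : ℂ) + ((2 / 3 * s : ℝ) : ℂ) * Complex.I := by push_cast; ring
  rw [this, Complex.add_re, Complex.ofReal_re, Complex.re_ofReal_mul, Complex.I_re]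
  nlinarith [sq_nonneg s]

/-- With ρ = τ exp(u), dividing the polynomial by ρτ gives 4exp(u) + exp(-u) - exp(-is) - 4. The
coefficients 2/3 and 2/27 are those for which its expansion vanishes to second order in s. -/
theorem norm_walkRoot_poly_le {s : ℝ} (hs : |s| ≤ 1) {τ : ℂ} (hτ : τ = Complex.exp (s * Complex.I)) :
    ‖4 * walkRoot s ^ 2 - (1 + 4 * τ) * walkRoot s + τ ^ 2‖ ≤ 7 * |s| ^ 3 := by
  set u : ℂ := -(1 / 3 * s * Complex.I) - 2 / 27 * s ^ 2 with hu
  have hτ1 : ‖τ‖ = 1 := by rw [hτ, Complex.norm_exp_ofReal_mul_I]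
  have hns : ‖(s : ℂ)‖ = |s| := by simp
  have hs2 : |s| ^ 2 ≤ |s| := by nlinarith [abs_nonneg s]
  have hun : ‖u‖ ≤ |s| := by
    refine (norm_sub_le _ _).trans ?_
    simp only [norm_neg, norm_mul, norm_pow, hns, Complex.norm_I, norm_div, Complex.norm_ofNat,
      norm_one]
    linarith [abs_nonneg s]
  have h1 := norm_exp_sub_quadratic_le (hun.trans hs)
  have h2 := norm_exp_sub_quadratic_le (x := -u) (by rw [norm_neg]; exact hun.trans hs)
  have h3 := norm_exp_sub_quadratic_le (x := -(s * Complex.I)) (by simpa using hs)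
  have hroot : walkRoot s = τ * Complex.exp u := by
    rw [walkRoot, hτ, ← Complex.exp_add]
    congr 1
    rw [hu]; ring
  have hroot' : walkRoot s * Complex.exp (-u) = τ := by
    rw [hroot, mul_assoc, ← Complex.exp_add]; simp
  have hinv : τ * Complex.exp (-(s * Complex.I)) = 1 := by
    rw [hτ, ← Complex.exp_add]; simp
  have hfac : 4 * walkRoot s ^ 2 - (1 + 4 * τ) * walkRoot s + τ ^ 2 =
      walkRoot s * τ * ((4 * (Complex.exp u - (1 + u + u ^ 2 / 2)) +
        (Complex.exp (-u) - (1 + -u + (-u) ^ 2 / 2))) -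
        (Complex.exp (-(s * Complex.I)) -
          (1 + -(s * Complex.I) + (-(s * Complex.I)) ^ 2 / 2)) +
        (10 / 81 * Complex.I + 10 / 729 * s) * s ^ 3) := by
    -- The quadratic Taylor parts leave only terms in s³ and s⁴. With the three Taylor remainders,
    -- of weights 4, 1 and 1, the constant is 4 + 1 + 1 + 1 = 7.
    have hpoly : (4 * (1 + u + u ^ 2 / 2) + (1 + -u + (-u) ^ 2 / 2) -
        (1 + -(s * Complex.I) + (-(s * Complex.I)) ^ 2 / 2)) =
        4 + (10 / 81 * Complex.I + 10 / 729 * s) * (s : ℂ) ^ 3 := by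
      rw [hu]; linear_combination (5 / 18 * (s : ℂ) ^ 2 - 1 / 2 * (s : ℂ) ^ 2) * Complex.I_sq
    linear_combination (4 * walkRoot s) * hroot + walkRoot s * hinv - τ * hroot'
      + walkRoot s * τ * hpoly
  rw [hfac, norm_mul, norm_mul, hτ1, mul_one]
  have hu3 : ‖u‖ ^ 3 ≤ |s| ^ 3 := pow_le_pow_left₀ (norm_nonneg _) hun 3
  rw [norm_neg] at h2
  rw [norm_neg, norm_mul, Complex.norm_I, hns, mul_one] at h3
  have h4 : ‖(10 / 81 * Complex.I + 10 / 729 * s) * (s : ℂ) ^ 3‖ ≤ 1 * |s| ^ 3 := by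
    rw [norm_mul, norm_pow, hns]
    refine mul_le_mul_of_nonneg_right ((norm_add_le _ _).trans ?_) (by positivity)
    simp only [norm_mul, hns, Complex.norm_I, norm_div, Complex.norm_ofNat, norm_one]
    linarith
  refine (mul_le_of_le_one_left (norm_nonneg _) (norm_walkRoot_le s)).trans ?_
  refine (norm_add_le _ _).trans ?_
  refine (add_le_add (norm_sub_le _ _) le_rfl).trans ?_
  refine (add_le_add (add_le_add (norm_add_le _ _) le_rfl) le_rfl).trans ?_
  rw [norm_mul, Complex.norm_ofNat]
  linarith

variable {n : ℕ} {G : RibbonGraph (FanEdge n)}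

/-- Subtracting r(E) = n + 2 from the counter divides by τ^(n+2), which turns (τρ)^(n+2) into
ρ^(n+2). -/
theorem norm_charFun_pdLaw_sub_le (hG : G.IsEmbeddingOf (fanEnds n)) (hp : G.IsPlanar) {s : ℝ}
    (hs : |s| ≤ 1) :
    ‖charFun G.pdLaw s - walkRoot s ^ (n + 2)‖ ≤
      ‖(1 + Complex.exp (s * Complex.I)) / 2 - (2 * walkRoot s - Complex.exp (s * Complex.I))‖ +
        (n + 1) * (7 * |s| ^ 3 / 2) := by
  set τ := Complex.exp (s * Complex.I) with hτ
  have hτ1 : ‖τ‖ = 1 := Complex.norm_exp_ofReal_mul_I s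
  have hτ0 : τ ≠ 0 := Complex.exp_ne_zero _
  have h1 : charFun G.pdLaw s =
      (τ ^ (n + 2))⁻¹ * walkMean ℂ (n + 1) (lastSpoke fun c => τ ^ c) := by
    rw [charFun_apply_real, integral_pdLaw hG hp, ← smul_eq_mul, ← map_smul]
    congr 1
    have : ∀ c : ℕ, Complex.exp (s * ((c - (n + 2) : ℝ) : ℂ) * Complex.I) =
        (τ ^ (n + 2))⁻¹ * τ ^ c := by
      intro c
      rw [hτ, ← Complex.exp_nat_mul, ← Complex.exp_nat_mul, ← Complex.exp_neg, ← Complex.exp_add]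
      congr 1
      push_cast
      ring
    simp only [this]
    ext ⟨_ | _, c⟩ <;> simp [lastSpoke]
    ring
  have h2 : walkRoot s ^ (n + 2) = (τ ^ (n + 2))⁻¹ * (τ * walkRoot s) ^ (n + 2) := by
    rw [mul_pow, inv_mul_cancel_left₀ (pow_ne_zero _ hτ0)]
  rw [h1, h2, ← mul_sub, norm_mul, norm_inv, norm_pow, hτ1, one_pow, inv_one, one_mul]
  refine (norm_walkMean_pow_sub_le hτ1 (norm_walkRoot_le s) n).trans ?_
  have := norm_walkRoot_poly_le hs hτ
  gcongr

end CharFun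

/-! ### Lévy's continuity theorem and the limit law -/

theorem isAsymptoticallyNormalWith_of_tendsto_charFun {μ : ℕ → Measure ℝ}
    [∀ n, IsProbabilityMeasure (μ n)] {m v : ℕ → ℝ}
    (h : ∀ θ : ℝ, Tendsto (fun n => Complex.exp (-(θ / √(v n) * m n * Complex.I)) *
      charFun (μ n) (θ / √(v n))) atTop (𝓝 (Complex.exp (-(θ ^ 2 / 2))))) :
    IsAsymptoticallyNormalWith μ m v := by
  intro x
  have hmeas : ∀ n, Measurable fun y : ℝ => (y - m n) / √(v n) := fun n => by fun_prop
  let ν : ℕ → ProbabilityMeasure ℝ := fun n =>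
    ⟨(μ n).map fun y => (y - m n) / √(v n), Measure.isProbabilityMeasure_map (hmeas n).aemeasurable⟩
  let γ : ProbabilityMeasure ℝ := ⟨gaussianReal 0 1, inferInstance⟩
  have hν : Tendsto ν atTop (𝓝 γ) := by
    refine ProbabilityMeasure.tendsto_of_tendsto_charFun fun θ => ?_
    have hγ : charFun (γ : Measure ℝ) θ = Complex.exp (-(θ ^ 2 / 2)) := by
      change charFun (gaussianReal 0 1) θ = _
      rw [charFun_gaussianReal]
      congr 1
      push_cast
      ring
    rw [hγ]
    refine (h θ).congr fun n => ?_
    change _ = charFun ((μ n).map fun y => (y - m n) / √(v n)) θ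
    rw [charFun_apply_real, charFun_apply_real, integral_map (hmeas n).aemeasurable
      (by fun_prop), ← integral_const_mul]
    congr 1
    ext y
    rw [← Complex.exp_add]
    congr 1
    push_cast
    ring
  -- The Gaussian has no atoms, so weak convergence gives convergence on every half-line.
  have hfr : γ (frontier (Set.Iic x)) = 0 := by
    rw [frontier_Iic]
    have := nullSingletonClass_gaussianReal (μ := 0) (v := 1) one_ne_zero
    have h0 : gaussianReal 0 1 {x} = 0 := measure_singleton x
    change (gaussianReal 0 1 {x}).toNNReal = 0
    rw [h0, ENNReal.toNNReal_zero]
  have hlim := ProbabilityMeasure.tendsto_measure_of_null_frontier_of_tendsto hν hfr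
  have hlim' := (NNReal.tendsto_coe.2 hlim)
  have hval : ((γ (Set.Iic x) : NNReal) : ℝ) =
      ∫ u in Set.Iic x, 1 / √(2 * Real.pi) * Real.exp (-(1 / 2) * u ^ 2) := by
    change (gaussianReal 0 1 (Set.Iic x)).toReal = _
    rw [gaussianReal_apply_eq_integral 0 one_ne_zero, ENNReal.toReal_ofReal
      (integral_nonneg fun u => gaussianPDFReal_nonneg _ _ _)]
    congr 1
    ext u
    rw [gaussianPDFReal]
    congr 1
    · simp
    · congr 1
      push_cast
      ring
  rw [hval] at hlim'
  refine hlim'.congr fun n => ?_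
  change ((μ n).map (fun y => (y - m n) / √(v n)) (Set.Iic x)).toReal = _
  rw [Measure.map_apply (hmeas n) measurableSet_Iic]
  rfl

/-- A centring error o(√n) and a relative scaling error o(1) do not affect the limit, so the exact
moments and their asymptotic forms are both covered. -/
theorem isAsymptoticallyNormalWith_fan {F : ∀ n : ℕ, RibbonGraph (FanEdge n)}
    (hF : ∀ n, (F n).IsEmbeddingOf (fanEnds n)) (hplanar : ∀ n, (F n).IsPlanar) {m v : ℕ → ℝ}
    (hm : Tendsto (fun n : ℕ => (2 / 3 * (n : ℝ) - m n) / √n) atTop (𝓝 0))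
    (hv : Tendsto (fun n : ℕ => v n / n) atTop (𝓝 (4 / 27))) :
    IsAsymptoticallyNormalWith (fun n => (F n).pdLaw) m v := by
  apply isAsymptoticallyNormalWith_of_tendsto_charFun
  intro θ
  set s : ℕ → ℝ := fun n => θ / √(v n) with hs
  have hpos : ∀ᶠ n : ℕ in atTop, 0 < (n : ℝ) := by
    filter_upwards [eventually_gt_atTop 0] with n hn
    exact_mod_cast hn
  have hratio : Tendsto (fun n : ℕ => √n / √(v n)) atTop (𝓝 (√(27 / 4))) := by
    have h1 := (hv.inv₀ (by norm_num)).sqrt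
    rw [show ((4 / 27 : ℝ))⁻¹ = 27 / 4 by norm_num] at h1
    refine h1.congr' ?_
    filter_upwards [hpos] with n hn
    rw [inv_div, Real.sqrt_div hn.le]
  have hsn : Tendsto (fun n : ℕ => s n * √n) atTop (𝓝 (θ * √(27 / 4))) := by
    refine (hratio.const_mul θ).congr fun n => ?_
    rw [hs]; ring
  have hsqrt : Tendsto (fun n : ℕ => √(n : ℝ)) atTop atTop :=
    Real.tendsto_sqrt_atTop.comp tendsto_natCast_atTop_atTop
  have hs0 : Tendsto s atTop (𝓝 0) := by
    refine (hsn.div_atTop hsqrt).congr' ?_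
    filter_upwards [hpos] with n hn
    rw [mul_div_cancel_right₀ _ (Real.sqrt_pos.2 hn).ne']
  have hs2 : Tendsto (fun n : ℕ => s n ^ 2 * n) atTop (𝓝 (θ ^ 2 * (27 / 4))) := by
    have := hsn.pow 2
    rw [mul_pow, Real.sq_sqrt (by norm_num)] at this
    refine this.congr fun n => ?_
    rw [mul_pow, Real.sq_sqrt n.cast_nonneg]
  have hs2' : Tendsto (fun n : ℕ => s n ^ 2 * (n + 2)) atTop (𝓝 (θ ^ 2 * (27 / 4))) := by
    have := hs2.add ((hs0.pow 2).mul_const 2)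
    simp only [ne_eq, OfNat.ofNat_ne_zero, not_false_eq_true, zero_pow, zero_mul, add_zero] at this
    exact this.congr fun n => by ring
  have hshift : Tendsto (fun n : ℕ => s n * (2 / 3 * (n + 2) - m n)) atTop (𝓝 0) := by
    have := (hsn.mul hm).add (hs0.mul_const (4 / 3))
    simp only [mul_zero, zero_mul, add_zero] at this
    refine this.congr' ?_
    filter_upwards [hpos] with n hn
    have := (Real.sqrt_pos.2 hn).ne'
    field_simp
    ring
  -- The first term is continuous in s and vanishes at 0; the second is (s²n + s²)|s| up to a
  -- constant, with s²n convergent and s tending to 0.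
  have herr : Tendsto (fun n : ℕ => ‖(1 + Complex.exp (s n * Complex.I)) / 2 -
      (2 * walkRoot (s n) - Complex.exp (s n * Complex.I))‖ + (n + 1) * (7 * |s n| ^ 3 / 2))
      atTop (𝓝 0) := by
    have h1 : Continuous fun s : ℝ => ‖(1 + Complex.exp (s * Complex.I)) / 2 -
      (2 * walkRoot s - Complex.exp (s * Complex.I))‖ := by unfold walkRoot; fun_prop
    have h2 := (h1.tendsto 0).comp hs0
    have h3 := (((hs2.add (hs0.pow 2)).mul hs0.abs).const_mul (7 / 2))
    have h4 := h2.add h3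
    have h5 : ‖(1 + Complex.exp ((0 : ℝ) * Complex.I)) / 2 -
      (2 * walkRoot 0 - Complex.exp ((0 : ℝ) * Complex.I))‖ = 0 := by
      simp [walkRoot]; norm_num
    rw [h5, abs_zero, mul_zero, mul_zero, add_zero] at h4
    refine h4.congr fun n => ?_
    simp only [Function.comp_apply]
    rw [← sq_abs (s n)]
    ring
  have hmain : Tendsto (fun n : ℕ => Complex.exp (-(s n * m n * Complex.I)) *
      walkRoot (s n) ^ (n + 2)) atTop (𝓝 (Complex.exp (-(θ ^ 2 / 2)))) := by
    have h1 : Tendsto (fun n : ℕ => ((s n * (2 / 3 * (n + 2) - m n) : ℝ) : ℂ) * Complex.I -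
        2 / 27 * ((s n ^ 2 * (n + 2) : ℝ) : ℂ)) atTop
        (𝓝 (((0 : ℝ) : ℂ) * Complex.I - 2 / 27 * ((θ ^ 2 * (27 / 4) : ℝ) : ℂ))) :=
      (((Complex.continuous_ofReal.tendsto _).comp hshift).mul_const _).sub
        (((Complex.continuous_ofReal.tendsto _).comp hs2').const_mul _)
    -- The Gaussian exponent arises as 2/27 · 27/4 = 1/2.
    have h2 : (((0 : ℝ) : ℂ) * Complex.I - 2 / 27 * ((θ ^ 2 * (27 / 4) : ℝ) : ℂ)) =
        -(θ ^ 2 / 2) := by push_cast; ring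
    rw [h2] at h1
    refine ((Complex.continuous_exp.tendsto _).comp h1).congr fun n => ?_
    rw [Function.comp_apply, walkRoot, ← Complex.exp_nat_mul, ← Complex.exp_add]
    congr 1
    push_cast
    ring
  have hdiff : Tendsto (fun n : ℕ => Complex.exp (-(s n * m n * Complex.I)) *
      (charFun (F n).pdLaw (s n) - walkRoot (s n) ^ (n + 2))) atTop (𝓝 0) := by
    refine squeeze_zero_norm' ?_ herr
    filter_upwards [hs0.abs.eventually_le_const (show |(0 : ℝ)| < 1 by simp)] with n hn
    rw [norm_mul, show -((s n : ℂ) * m n * Complex.I) = ((-(s n * m n) : ℝ) : ℂ) * Complex.I by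
      push_cast; ring, Complex.norm_exp_ofReal_mul_I, one_mul]
    exact norm_charFun_pdLaw_sub_le (hF n) (hplanar n) hn
  have := hmain.add hdiff
  rw [add_zero] at this
  refine this.congr fun n => ?_
  simp only [hs]
  push_cast
  ring

/-! ### From the exact moments to their asymptotics -/

theorem tendsto_natCast_mul_pow_quarter :
    Tendsto (fun n : ℕ => (n : ℝ) * (1 / 4) ^ (n + 1)) atTop (𝓝 0) := by
  have := (tendsto_self_mul_const_pow_of_lt_one (r := (1 / 4 : ℝ)) (by norm_num)
    (by norm_num)).mul_const (1 / 4)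
  rw [zero_mul] at this
  exact this.congr fun n => by ring

theorem tendsto_pow_quarter : Tendsto (fun n : ℕ => (1 / 4 : ℝ) ^ (n + 1)) atTop (𝓝 0) :=
  (tendsto_pow_atTop_nhds_zero_of_lt_one (by norm_num) (by norm_num)).comp (tendsto_add_atTop_nat 1)

/-- The difference stays bounded while `a * (n + b)` is unbounded, so the shift `b` is arbitrary. -/
theorem isEquivalent_of_tendsto_sub {u : ℕ → ℝ} {a b c : ℝ} (ha : a ≠ 0)
    (h : Tendsto (fun n : ℕ => u n - a * n) atTop (𝓝 c)) :
    Asymptotics.IsEquivalent atTop u fun n : ℕ => a * (n + b) := by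
  have h1 : Tendsto (fun n : ℕ => u n - a * (n + b)) atTop (𝓝 (c - a * b)) :=
    (h.sub_const (a * b)).congr fun n => by ring
  have h2 : Tendsto (fun n : ℕ => ‖a * ((n : ℝ) + b)‖) atTop atTop := by
    simp only [norm_mul]
    exact (tendsto_norm_atTop_atTop.comp (tendsto_atTop_add_const_right _ _
      tendsto_natCast_atTop_atTop)).const_mul_atTop (norm_pos_iff.2 ha)
  exact (h1.isBigO_one ℝ).trans_isLittleO ((Asymptotics.isLittleO_const_left).2 (Or.inr h2))

theorem tendsto_div_natCast_of_tendsto_sub {u : ℕ → ℝ} {a c : ℝ}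
    (h : Tendsto (fun n : ℕ => u n - a * n) atTop (𝓝 c)) :
    Tendsto (fun n : ℕ => u n / n) atTop (𝓝 a) := by
  have := (h.div_atTop tendsto_natCast_atTop_atTop).add_const a
  rw [zero_add] at this
  refine this.congr' ?_
  filter_upwards [eventually_gt_atTop 0] with n hn
  have : (n : ℝ) ≠ 0 := by exact_mod_cast hn.ne'
  field_simp
  ring

theorem tendsto_sub_div_sqrt_of_tendsto_sub {u : ℕ → ℝ} {a c : ℝ}
    (h : Tendsto (fun n : ℕ => u n - a * n) atTop (𝓝 c)) :
    Tendsto (fun n : ℕ => (a * n - u n) / √n) atTop (𝓝 0) :=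
  (h.neg.div_atTop (Real.tendsto_sqrt_atTop.comp tendsto_natCast_atTop_atTop)).congr fun n => by
    simp

theorem mainTheorem7
    (F : ∀ n : ℕ, RibbonGraph (FanEdge n))
    (hF : ∀ n, (F n).IsEmbeddingOf (fanEnds n))
    (hplanar : ∀ n, (F n).IsPlanar) :
    IsAsymptoticallyNormalWith (fun n => (F n).pdLaw)
        (fun n => (F n).pdMean) (fun n => (F n).pdVariance) ∧
      Asymptotics.IsEquivalent atTop (fun n => (F n).pdMean)
        (fun n : ℕ => 2 * ((n : ℝ) + 3) / 3) ∧
      Asymptotics.IsEquivalent atTop (fun n => (F n).pdVariance)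
        (fun n : ℕ => 4 * ((n : ℝ) + 3) / 27) ∧
      IsAsymptoticallyNormalWith (fun n => (F n).pdLaw)
        (fun n => 2 * ((n : ℝ) + 3) / 3) (fun n => 4 * ((n : ℝ) + 3) / 27) := by
  have hmean : Tendsto (fun n : ℕ => (F n).pdMean - 2 / 3 * n) atTop (𝓝 (13 / 9)) := by
    have := (tendsto_pow_quarter.div_const 36).const_sub (13 / 9)
    rw [zero_div, sub_zero] at this
    exact this.congr fun n => by rw [pdMean_fan (hF n) (hplanar n)]; ring
  have hvar : Tendsto (fun n : ℕ => (F n).pdVariance - 4 / 27 * n) atTop (𝓝 (32 / 81)) := by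
    have := (((tendsto_pow_quarter.const_mul (31 / 324)).add
      (tendsto_natCast_mul_pow_quarter.div_const 27)).add
      ((tendsto_pow_quarter.pow 2).div_const 1296)).const_sub (32 / 81)
    norm_num at this
    exact this.congr fun n => by rw [pdVariance_fan (hF n) (hplanar n)]; ring
  have hmean' : Tendsto (fun n : ℕ => 2 * ((n : ℝ) + 3) / 3 - 2 / 3 * n) atTop (𝓝 2) :=
    tendsto_const_nhds.congr fun n => by ring
  have hvar' : Tendsto (fun n : ℕ => 4 * ((n : ℝ) + 3) / 27 - 4 / 27 * n) atTop (𝓝 (4 / 9)) :=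
    tendsto_const_nhds.congr fun n => by ring
  refine ⟨isAsymptoticallyNormalWith_fan hF hplanar (tendsto_sub_div_sqrt_of_tendsto_sub hmean)
    (tendsto_div_natCast_of_tendsto_sub hvar), ?_, ?_,
    isAsymptoticallyNormalWith_fan hF hplanar (tendsto_sub_div_sqrt_of_tendsto_sub hmean')
    (tendsto_div_natCast_of_tendsto_sub hvar')⟩
  · convert isEquivalent_of_tendsto_sub (b := 3) (by norm_num) hmean using 2 with n
    ring
  · convert isEquivalent_of_tendsto_sub (b := 3) (by norm_num) hvar using 2 with n
    ring
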